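/- **Setting.** Let $d\ge 2$, $\alpha>d$ and $J>0$, let $|\cdot|$ be the $\ell^1$-norm on $\mathbb Z^d$, and put $J_{x,y}=J|x-y|^{-\alpha}$ for $x\ne y$, $J_{x,x}=0$. Connectedness refers to the nearest-neighbour graph. For a finite $\Lambda\subset\mathbb Z^d$ let $\Omega_\Lambda^+$ be the set of all $\sigma\in\{-1,1\}^{\mathbb Z^d}$ with $\sigma_x=+1$ for $x\notin\Lambda$, and $$\mathcal H^{+}_\Lambda(\sigma)=-\sum_{x,y\in\Lambda}J_{x,y}\sigma_x\sigma_y-\sum_{x\in\Lambda,\,y\in\Lambda^c}J_{x,y}\sigma_x .$$ For $A\subset\mathbb Z^d$ put $F_A=\sum_{x\in A,\,y\in A^c}J_{x,y}$, let $I(A)$ be the union of the bounded connected components of $A^c$, and $V(A)=A\cup I(A)$. **Contours.** Let $\partial\sigma$ be the set of all $x$ such that $\sigma$ is not constant on $\{y:|x-y|\le1\}$. For $M,a,r>0$, an $(M,a,r)$-partition of $\partial\sigma$ is a finite partition $\Gamma(\sigma)$ of $\partial\sigma$ into non-empty sets such that for any two distinct $\gamma,\gamma'\in\Gamma(\sigma)$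 the set $\gamma'$ lies in a single connected component of $\gamma^c$, and such that every $\gamma\in\Gamma(\sigma)$ can be written as a union $\gamma=\bigcup_{k=1}^{n}\gamma_k$ with $1\le n\le 2^r-1$ in such a way that, for all distinct $\gamma,\gamma'\in\Gamma(\sigma)$, $$\mathrm d(\gamma,\gamma')>M\,\max\Big\{1,\min\big\{\max_k\operatorname{diam}\gamma_k,\ \max_j\operatorname{diam}\gamma'_j\big\}\Big\}^{a}.$$ The elements $\gamma$ of $\Gamma(\sigma)$ are (the supports $\mathrm{sp}(\gamma)=\gamma$ of) the contours of $\sigma$, and $|\gamma|$ is the number of sites of $\gamma$. The label of $\gamma$ is $+1$ if $\sigma=+1$ on the set of all points outside $V(\gamma)$ that have a neighbour in $V(\gamma)$. A connected component $C$ of $I(\gamma)$ has label $\pm1$ if $\sigma=\pm1$ at all points of $V(C)$ that have a neighbour outside $V(C)$; $I_\pm(\gamma)$ is the union of the components of $I(\gamma)$ with label $\pm1$. **Flip.** For a family $\Gamma\subset\Gamma(\sigma)$ let $\tau_\Gamma(\sigma)_x=+1$ if $x\in\bigcup_{\gamma\in\Gamma}\mathrm{sp}(\gamma)$, $\tau_\Gamma(\sigma)_x=-\sigma_x$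 if $x\in\bigcup_{\gamma\in\Gamma}I_-(\gamma)$, and $\tau_\Gamma(\sigma)_x=\sigma_x$ otherwise. **Proposition.** Let $a>\frac{d+1}{\min\{\alpha-d,1\}}$ and $r>0$. There are constants $M_0,c_1',c_2',c_3'>0$, depending only on $d,\alpha,J,a,r$, such that the following holds for all $M\ge M_0$, all finite $\Lambda\subset\mathbb Z^d$, all $\sigma\in\Omega_\Lambda^+$ and every $(M,a,r)$-partition $\Gamma(\sigma)$ of $\partial\sigma$. If $\Gamma\subset\Gamma(\sigma)$ is a family of contours with label $+1$ and $V(\gamma)\subset\Lambda$ for all $\gamma\in\Gamma$, which are external to each other ($\gamma\not\subset V(\gamma')$ for distinct $\gamma,\gamma'\in\Gamma$), then $$\mathcal H^{+}_\Lambda(\tau_\Gamma(\sigma))-\mathcal H^{+}_\Lambda(\sigma)\le\sum_{\gamma\in\Gamma}\Big(-c_1'|\gamma|-c_2'F_{I_-(\gamma)}-c_3'F_{\mathrm{sp}(\gamma)}\Big).$$ In particular, for $\Gamma=\{\gamma\}$ the right-hand side is $-c_1'|\gamma|-c_2'F_{I_-(\gamma)}-c_3'F_{\mathrm{sp}(\gamma)}$.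 -/

import Mathlib

namespace LongRangeIsing

/-- The sites of the lattice `ℤ^d`. -/
abbrev Site (d : ℕ) : Type := Fin d → ℤ

/-- Spin configurations; `ℤˣ = {1, -1}`. -/
abbrev Config (d : ℕ) : Type := Site d → ℤˣ

/-- The `ℓ¹` distance on `ℤ^d`. -/
def l1dist {d : ℕ} (x y : Site d) : ℕ := ∑ i, (x i - y i).natAbs

/-- The nearest-neighbour graph on `ℤ^d`. -/
def lattice (d : ℕ) : SimpleGraph (Site d) where
  Adj x y := l1dist x y = 1
  symm := ⟨fun x y h => by
    have e : l1dist y x = l1dist x y :=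
      Finset.sum_congr rfl fun i _ => by rw [← Int.natAbs_neg, neg_sub]
    rw [e]; exact h⟩
  loopless := ⟨fun x h => by simp [l1dist] at h⟩

/-! ### Energy -/

noncomputable section

/-- The couplings `J |x - y|^{-α}` for `x ≠ y`, and `0` for `x = y`. -/
def coupling {d : ℕ} (J α : ℝ) (x y : Site d) : ℝ :=
  if x = y then 0 else J * (l1dist x y : ℝ) ^ (-α)

/-- A spin as a real number. -/
def spin {d : ℕ} (σ : Config d) (x : Site d) : ℝ := ((σ x : ℤ) : ℝ)

/-- The Hamiltonian in the finite volume `Λ` with boundary condition `η`; the first sum runs over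
all `(x, y) ∈ Λ × Λ`. -/
def hamiltonian {d : ℕ} (J α : ℝ) (Λ : Finset (Site d)) (η σ : Config d) : ℝ :=
  - (∑ x ∈ Λ, ∑ y ∈ Λ, coupling J α x y * spin σ x * spin σ y)
    - ∑ x ∈ Λ, ∑' y : {y : Site d // y ∉ Λ}, coupling J α x y * spin σ x * spin η y

/-- The `+` boundary condition. -/
def plus (d : ℕ) : Config d := fun _ => 1

/-- The configurations that agree with `η` outside `Λ`. -/
def configsWithBC {d : ℕ} (Λ : Finset (Site d)) (η : Config d) : Set (Config d) :=
  {σ | ∀ x, x ∉ Λ → σ x = η x}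

/-- `F_A`, the sum of the couplings between `A` and its complement. -/
def surfaceEnergy {d : ℕ} (J α : ℝ) (A : Set (Site d)) : ℝ :=
  ∑' x : A, ∑' y : (Aᶜ : Set (Site d)), coupling J α (x : Site d) (y : Site d)

end

/-! ### Geometry of subsets of the lattice -/

/-- The connected component of `x` in the subgraph induced by `A` (empty if `x ∉ A`). -/
def component {d : ℕ} (A : Set (Site d)) (x : Site d) : Set (Site d) :=
  {y | ∃ (hx : x ∈ A) (hy : y ∈ A), ((lattice d).induce A).Reachable ⟨x, hx⟩ ⟨y, hy⟩}

/-- `I(A)`, the union of the bounded connected components of `Aᶜ`. -/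
def inside {d : ℕ} (A : Set (Site d)) : Set (Site d) :=
  {x | x ∉ A ∧ (component Aᶜ x).Finite}

/-- `V(A) = A ∪ I(A)`. -/
def volume {d : ℕ} (A : Set (Site d)) : Set (Site d) := A ∪ inside A

/-- The points of `A` with a neighbour outside `A`. -/
def innerBoundary {d : ℕ} (A : Set (Site d)) : Set (Site d) :=
  {x | x ∈ A ∧ ∃ y, y ∉ A ∧ (lattice d).Adj x y}

/-- The points outside `A` with a neighbour in `A`. -/
def outerBoundary {d : ℕ} (A : Set (Site d)) : Set (Site d) :=
  {x | x ∉ A ∧ ∃ y, y ∈ A ∧ (lattice d).Adj x y}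

/-- The `ℓ¹` diameter of a finite set. -/
def diam {d : ℕ} (A : Finset (Site d)) : ℕ := (A ×ˢ A).sup fun p => l1dist p.1 p.2

/-- The largest diameter of a member of a finite family of sets. -/
def maxDiam {d : ℕ} (F : Finset (Finset (Site d))) : ℕ := F.sup diam

/-! ### Contours -/

/-- `∂σ`, the set of incorrect points: those `x` for which `σ` is not constant on the closed
`ℓ¹` unit ball around `x`. -/
def boundary {d : ℕ} (σ : Config d) : Set (Site d) :=
  {x | ∃ y, (lattice d).Adj x y ∧ σ y ≠ σ x}

/-- `P` is an `(M, a, r)`-partition of `∂σ`; its members are the supports of the contours of `σ`.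
In `separated`, each `γ ∈ P` is cut into at least one and at most `2^r - 1` pieces. The cut-off by
`1` is there since a piece that is a single site has diameter `0`. -/
structure IsContourPartition {d : ℕ} (M a r : ℝ) (σ : Config d)
    (P : Finset (Finset (Site d))) : Prop where
  nonempty : ∀ γ ∈ P, γ.Nonempty
  disjoint : ∀ γ ∈ P, ∀ γ' ∈ P, γ ≠ γ' → Disjoint γ γ'
  cover : ∀ x, x ∈ boundary σ ↔ ∃ γ ∈ P, x ∈ γ
  one_component : ∀ γ ∈ P, ∀ γ' ∈ P, γ ≠ γ' →
    ∃ x, (γ' : Set (Site d)) ⊆ component ((γ : Set (Site d))ᶜ) x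
  separated : ∃ pieces : Finset (Site d) → Finset (Finset (Site d)),
    (∀ γ ∈ P, 1 ≤ (pieces γ).card ∧ ((pieces γ).card : ℝ) ≤ (2 : ℝ) ^ r - 1 ∧
      (pieces γ).sup id = γ) ∧
    ∀ γ ∈ P, ∀ γ' ∈ P, γ ≠ γ' → ∀ x ∈ γ, ∀ y ∈ γ',
      M * ((max 1 (min (maxDiam (pieces γ)) (maxDiam (pieces γ'))) : ℕ) : ℝ) ^ a < (l1dist x y : ℝ)

/-- The contour with support `γ` has (outer) label `s`: the spins on the outer boundary of `V(γ)`
are `s`. -/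
def HasLabel {d : ℕ} (σ : Config d) (γ : Finset (Site d)) (s : ℤˣ) : Prop :=
  ∀ x ∈ outerBoundary (volume (γ : Set (Site d))), σ x = s

/-- `I_s(γ)`: the union of those connected components `C` of `I(γ)` that have label `s`, that is,
the spins on the inner boundary of `V(C)` are `s`. -/
def labelledInside {d : ℕ} (σ : Config d) (γ : Finset (Site d)) (s : ℤˣ) : Set (Site d) :=
  {x | x ∈ inside (γ : Set (Site d)) ∧
    ∀ y ∈ innerBoundary (volume (component ((γ : Set (Site d))ᶜ) x)), σ y = s}

/-- `Γ` is a family of contours of `σ`, out of the partition `P`, that are external to each other,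
have label `s`, and whose volumes lie in `Λ`. -/
structure IsExternalFamily {d : ℕ} (Λ : Finset (Site d)) (σ : Config d)
    (P Γ : Finset (Finset (Site d))) (s : ℤˣ) : Prop where
  subset : Γ ⊆ P
  external : ∀ γ ∈ Γ, ∀ γ' ∈ Γ, γ ≠ γ' → ¬ ((γ : Set (Site d)) ⊆ volume (γ' : Set (Site d)))
  label : ∀ γ ∈ Γ, HasLabel σ γ s
  volume_subset : ∀ γ ∈ Γ, volume (γ : Set (Site d)) ⊆ (Λ : Set (Site d))

open Classical in
/-- The flip `τ_Γ` for contours of label `+1`: the spins on the supports become `+1`, those in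
`I_-(Γ)` are reversed, and those in `I_+(Γ)` and outside `V(Γ)` are kept. -/
noncomputable def contourFlip {d : ℕ} (Γ : Finset (Finset (Site d))) (σ : Config d) : Config d :=
  fun x =>
    if ∃ γ ∈ Γ, x ∈ γ then 1
    else if ∃ γ ∈ Γ, x ∈ labelledInside σ γ (-1) then - σ x
    else σ x

end LongRangeIsing

/-!
Contours are more than two apart and `ℤ^d` with `d ≥ 2` has no holes and a single end, so each
contour `γ` carries a spin `s_γ` of its own: it is `+1` far away, and the edges across which it
changes are the edges meeting `γ` across which `σ` does. Hence `σ = ∏ s_γ`, the flip multiplies `σ`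
by the spins of `Γ`, and it lowers the energy in proportion to the coupling of the pairs of sites
that these spins separate, except for the pairs that another contour separates too. The latter
make up a small fraction when `M` is large: a contour of larger scale is too far away, because the
coupling decays, and for contours of smaller scale `D` one averages over a cube of side about
`M D ^ a`, which meets at most one of them for each scale, and sums over the scales.
-/

namespace LongRangeIsing

variable {d : ℕ}

/-! ### Functions that are locally constant off a set of sites -/

theorem l1dist_self (x : Site d) : l1dist x x = 0 := by simp [l1dist]

theorem l1dist_comm (x y : Site d) : l1dist x y = l1dist y x :=
  Finset.sum_congr rfl fun i _ => by rw [← Int.natAbs_neg, neg_sub]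

theorem l1dist_triangle (x y z : Site d) : l1dist x z ≤ l1dist x y + l1dist y z := by
  unfold l1dist
  rw [← Finset.sum_add_distrib]
  exact Finset.sum_le_sum fun i _ => by omega

theorem natAbs_sub_le_l1dist (x y : Site d) (i : Fin d) : (x i - y i).natAbs ≤ l1dist x y :=
  Finset.single_le_sum (f := fun i => (x i - y i).natAbs) (fun _ _ => Nat.zero_le _)
    (Finset.mem_univ i)

theorem l1dist_update (x : Site d) (i : Fin d) (u v : ℤ) :
    l1dist (Function.update x i u) (Function.update x i v) = (u - v).natAbs := by
  unfold l1dist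
  rw [Finset.sum_eq_single i (fun j _ hj => by simp [hj]) (by simp)]
  simp

theorem add_single_eq_update (x : Site d) (i : Fin d) (t : ℤ) :
    x + Pi.single i t = Function.update x i (x i + t) := by
  ext j
  by_cases hj : j = i
  · subst hj; simp
  · simp [hj]

theorem l1dist_add_single (x : Site d) (i : Fin d) (t : ℤ) :
    l1dist x (x + Pi.single i t) = t.natAbs := by
  have h := l1dist_update x i (x i) (x i + t)
  rw [Function.update_eq_self] at h
  rw [add_single_eq_update, h]
  omega

theorem adj_add_single (x : Site d) (i : Fin d) : (lattice d).Adj x (x + Pi.single i 1) :=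
  l1dist_add_single x i 1

theorem exists_eq_add_single_of_adj {x y : Site d} (hxy : (lattice d).Adj x y) :
    ∃ i, y = x + Pi.single i 1 ∨ x = y + Pi.single i 1 := by
  have hsum : ∑ i, (x i - y i).natAbs = 1 := hxy
  obtain ⟨i, hi, hpos⟩ : ∃ i ∈ Finset.univ, (x i - y i).natAbs ≠ 0 :=
    Finset.exists_ne_zero_of_sum_ne_zero (by omega)
  have hsplit := Finset.add_sum_erase Finset.univ (fun i => (x i - y i).natAbs) hi
  have hrest : ∀ j, j ≠ i → x j = y j := fun j hj => by
    have := Finset.single_le_sum (f := fun i => (x i - y i).natAbs) (fun _ _ => Nat.zero_le _)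
      (Finset.mem_erase.2 ⟨hj, Finset.mem_univ j⟩)
    omega
  refine ⟨i, ?_⟩
  simp only [add_single_eq_update, Function.eq_update_iff]
  rcases Int.natAbs_eq_iff.1 (show (x i - y i).natAbs = 1 by omega) with h | h
  · exact Or.inr ⟨by omega, hrest⟩
  · exact Or.inl ⟨by omega, fun j hj => (hrest j hj).symm⟩

/-- `s` takes equal values at neighbouring sites outside `A`, hence is constant on the connected
components of the complement of `A`. -/
def IsLocallyConstantOff {X : Type*} (A : Set (Site d)) (s : Site d → X) : Prop :=
  ∀ x y, (lattice d).Adj x y → x ∉ A → y ∉ A → s x = s y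

namespace IsLocallyConstantOff

variable {X : Type*} {A : Set (Site d)} {s : Site d → X}

theorem eq_of_segment (hs : IsLocallyConstantOff A s) (x : Site d) (i : Fin d) (u v : ℤ)
    (h : ∀ t ∈ Set.uIcc u v, Function.update x i t ∉ A) :
    s (Function.update x i u) = s (Function.update x i v) := by
  wlog huv : u ≤ v generalizing u v
  · exact (this v u (by rwa [Set.uIcc_comm]) (by omega)).symm
  rw [Set.uIcc_of_le huv] at h
  induction v, huv using Int.leInduction with
  | base => rfl
  | succ v huv ih =>
    rw [ih fun t ht => h t ⟨ht.1, ht.2.trans (by omega)⟩]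
    refine hs _ _ ?_ (h v ⟨huv, by omega⟩) (h (v + 1) ⟨by omega, le_rfl⟩)
    change l1dist _ _ = 1
    rw [l1dist_update]
    omega

theorem eq_of_box (hs : IsLocallyConstantOff A s) (x y : Site d)
    (h : ∀ z : Site d, (∀ i, z i ∈ Set.uIcc (x i) (y i)) → z ∉ A) : s x = s y := by
  suffices key : ∀ S : Finset (Fin d), s x = s (S.piecewise y x) by
    simpa using key Finset.univ
  intro S
  induction S using Finset.induction_on with
  | empty => simp
  | insert j S hj ih =>
    rw [ih, Finset.piecewise_insert,
      ← Function.update_eq_self j (S.piecewise y x), Finset.piecewise_eq_of_notMem S y x hj,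
      Function.update_idem]
    refine hs.eq_of_segment _ j _ _ fun t ht => h _ fun i => ?_
    by_cases hij : i = j
    · subst hij; simpa using ht
    · rw [Function.update_of_ne hij]
      by_cases hi : i ∈ S <;> simp [hi]

theorem eq_of_l1ball (hs : IsLocallyConstantOff A s) (x y : Site d)
    (h : ∀ z, l1dist x z ≤ l1dist x y → z ∉ A) : s x = s y := by
  refine hs.eq_of_box x y fun z hz => h z (Finset.sum_le_sum fun i _ => ?_)
  have := hz i
  rw [Set.mem_uIcc] at this
  omega

theorem eq_of_hyperplane (hs : IsLocallyConstantOff A s) (x y : Site d) (i : Fin d)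
    (hxy : x i = y i) (h : ∀ z : Site d, z i = x i → z ∉ A) : s x = s y := by
  refine hs.eq_of_box x y fun z hz => h z ?_
  have := hz i
  rw [← hxy, Set.mem_uIcc] at this
  omega

theorem eq_of_mem_component (hs : IsLocallyConstantOff A s) {x y : Site d}
    (hy : y ∈ component Aᶜ x) : s x = s y := by
  obtain ⟨hx, hy', ⟨w⟩⟩ := hy
  suffices key : ∀ u v : (Aᶜ : Set (Site d)), ((lattice d).induce Aᶜ).Walk u v → s u = s v from
    key _ _ w
  intro u v w
  induction w with
  | nil => rfl
  | @cons u v _ h _ ih => exact (hs u v h u.2 v.2).trans ih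

end IsLocallyConstantOff

theorem IsLocallyConstantOff.eq {X : Type*} {s : Site d → X} (hs : IsLocallyConstantOff ∅ s)
    (x y : Site d) : s x = s y :=
  hs.eq_of_box x y fun z _ => Set.notMem_empty z

theorem exists_boundary_edge {A : Set (Site d)} (hne : A.Nonempty) (hA : A ≠ Set.univ) :
    ∃ x ∈ A, ∃ y ∉ A, (lattice d).Adj x y := by
  by_contra! hcon
  obtain ⟨x, hx⟩ := hne
  obtain ⟨y, hy⟩ := (Set.ne_univ_iff_exists_notMem A).1 hA
  have hconst : IsLocallyConstantOff ∅ (· ∈ A) := fun u v huv _ _ =>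
    propext ⟨fun hu => by_contra fun hv => hcon u hu v hv huv,
      fun hv => by_contra fun hu => hcon v hv u hu huv.symm⟩
  exact hy (hconst.eq x y ▸ hx)

theorem exists_forall_abs_le {A : Set (Site d)} (hA : A.Finite) :
    ∃ N : ℕ, ∀ x ∈ A, ∀ i, |x i| ≤ N := by
  obtain ⟨N, hN⟩ := (hA.image (l1dist · 0)).bddAbove
  refine ⟨N, fun x hx i => ?_⟩
  have hle : l1dist x 0 ≤ N := hN ⟨x, hx, rfl⟩
  have hi := natAbs_sub_le_l1dist x 0 i
  simp only [Pi.zero_apply, sub_zero] at hi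
  rw [Int.abs_eq_natAbs]
  omega

theorem infinite_of_forall_update_mem {A : Set (Site d)} (x : Site d) (i : Fin d)
    (h : ∀ t : ℕ, Function.update x i (x i + t) ∈ A) : A.Infinite :=
  Set.infinite_of_injective_forall_mem (f := fun t : ℕ => Function.update x i (x i + t))
    (fun t t' htt => by simpa using congrFun htt i) h

-- Two hyperplanes orthogonal to different axes meet, and far out they avoid `A`.
theorem IsLocallyConstantOff.exists_finite_ne [Nontrivial (Fin d)] {X : Type*}
    {A : Set (Site d)} {s : Site d → X} (hs : IsLocallyConstantOff A s) (hA : A.Finite) :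
    ∃ c, {x | s x ≠ c}.Finite := by
  obtain ⟨N, hN⟩ := exists_forall_abs_le hA
  have hout : ∀ (z : Site d) (i : Fin d), (N : ℤ) < |z i| → z ∉ A :=
    fun z i hi hz => (hN z hz i).not_gt hi
  have hfar : ∀ (z : Site d) (i : Fin d), (N : ℤ) < |z i| → s z = s fun _ => (N : ℤ) + 1 := by
    intro z i hi
    obtain ⟨j, hj⟩ := exists_ne i
    calc s z = s (Function.update (fun _ => (N : ℤ) + 1) i (z i)) :=
          hs.eq_of_hyperplane _ _ i (by simp) fun w hw => hout w i (by rwa [hw])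
      _ = s fun _ => (N : ℤ) + 1 := by
          refine hs.eq_of_hyperplane _ _ j (by simp [hj]) fun w hw => hout w j ?_
          rw [hw, Function.update_of_ne hj]
          exact (lt_add_one _).trans_le (le_abs_self _)
  refine ⟨s fun _ => (N : ℤ) + 1, (Set.finite_Icc (fun _ : Fin d => -(N : ℤ)) fun _ => N).subset
    fun x hx => ?_⟩
  have hle : ∀ i, |x i| ≤ N := fun i => le_of_not_gt fun hi => hx (hfar x i hi)
  exact ⟨fun i => (abs_le.1 (hle i)).1, fun i => (abs_le.1 (hle i)).2⟩

/-! ### Components, insides and volumes -/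

theorem mem_component_self {A : Set (Site d)} {x : Site d} (hx : x ∈ A) : x ∈ component A x :=
  ⟨hx, hx, SimpleGraph.Reachable.refl _⟩

theorem mem_component_of_adj {A : Set (Site d)} {x y z : Site d} (hy : y ∈ component A x)
    (hz : z ∈ A) (hyz : (lattice d).Adj y z) : z ∈ component A x := by
  obtain ⟨hx, hy', hr⟩ := hy
  have hadj : ((lattice d).induce A).Adj ⟨y, hy'⟩ ⟨z, hz⟩ := hyz
  exact ⟨hx, hz, hr.trans hadj.reachable⟩

theorem component_eq_of_mem {A : Set (Site d)} {x y : Site d} (hy : y ∈ component A x) :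
    component A y = component A x := by
  obtain ⟨hx, hy', hr⟩ := hy
  ext z
  exact ⟨fun ⟨_, hz, h⟩ => ⟨hx, hz, hr.trans h⟩, fun ⟨_, hz, h⟩ => ⟨hy', hz, hr.symm.trans h⟩⟩

theorem isLocallyConstantOff_mem_component (A : Set (Site d)) (x : Site d) :
    IsLocallyConstantOff A (· ∈ component Aᶜ x) := fun _ _ huv hu hv =>
  propext ⟨fun h => mem_component_of_adj h hv huv, fun h => mem_component_of_adj h hu huv.symm⟩

theorem mem_inside_of_adj {A : Set (Site d)} {x y : Site d} (hx : x ∈ inside A) (hy : y ∉ A)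
    (hxy : (lattice d).Adj x y) : y ∈ inside A := by
  have hyc : y ∈ component Aᶜ x := mem_component_of_adj (mem_component_self hx.1) hy hxy
  exact ⟨hy, by rw [component_eq_of_mem hyc]; exact hx.2⟩

theorem mem_of_adj_of_mem_volume {A : Set (Site d)} {x y : Site d} (hx : x ∈ volume A)
    (hy : y ∉ volume A) (hxy : (lattice d).Adj x y) : x ∈ A :=
  hx.resolve_right fun hx => hy (Or.inr (mem_inside_of_adj hx (fun h => hy (Or.inl h)) hxy))

theorem volume_ne_univ [Nonempty (Fin d)] {A : Set (Site d)} (hA : A.Finite) :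
    volume A ≠ Set.univ := by
  obtain ⟨N, hN⟩ := exists_forall_abs_le hA
  let i : Fin d := Classical.arbitrary _
  let p : Site d := fun _ => N + 1
  have hray : ∀ t : ℤ, (N : ℤ) + 1 ≤ t → Function.update p i t ∉ A := fun t ht hmem => by
    have := hN _ hmem i
    rw [Function.update_self, abs_of_nonneg (by omega)] at this
    omega
  have hp : p ∉ A := by simpa [p] using hray (N + 1) le_rfl
  refine (Set.ne_univ_iff_exists_notMem _).2 ⟨p, ?_⟩
  rintro (h | h)
  · exact hp h
  · refine infinite_of_forall_update_mem (A := component Aᶜ p) p i (fun t => ?_) h.2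
    have hseg := (isLocallyConstantOff_mem_component A p).eq_of_segment p i (p i) (p i + t)
      fun u hu => hray u (Set.uIcc_of_le (show p i ≤ p i + t by omega) ▸ hu).1
    rw [Function.update_eq_self] at hseg
    exact hseg ▸ mem_component_self hp

theorem exists_boundary_edge_volume [Nonempty (Fin d)] {A : Set (Site d)} (hne : A.Nonempty)
    (hA : A.Finite) : ∃ x ∈ A, ∃ y ∉ volume A, (lattice d).Adj x y := by
  obtain ⟨x, hx, y, hy, hxy⟩ :=
    exists_boundary_edge (hne.mono Set.subset_union_left) (volume_ne_univ hA)
  exact ⟨x, mem_of_adj_of_mem_volume hx hy hxy, y, hy, hxy⟩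

/-! ### Closed cochains on the lattice are exact -/

section Potential

variable {G : Type*} [CommGroup G]

theorem exists_discrete_primitive (g : ℤ → G) : ∃ h : ℤ → G, ∀ n, h (n + 1) = h n * g n := by
  refine ⟨fun n => (∏ i ∈ Finset.Ico 0 n, g i) / ∏ i ∈ Finset.Ico n 0, g i, fun n => ?_⟩
  beta_reduce
  rcases le_or_gt 0 n with hn | hn
  · rw [Finset.Ico_eq_empty (a := n) (by omega), Finset.Ico_eq_empty (a := n + 1) (by omega),
      ← Finset.insert_Ico_right_eq_Ico_add_one hn, Finset.prod_insert (by simp)]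
    simp [mul_comm]
  · rw [Finset.Ico_eq_empty (b := n) (by omega), Finset.Ico_eq_empty (b := n + 1) (by omega),
      ← Finset.insert_Ico_add_one_left_eq_Ico (a := n) (b := 0) hn, Finset.prod_insert (by simp)]
    simp

theorem exists_primitive_along (i : Fin d) (g : Site d → G) :
    ∃ h : Site d → G, (∀ x, h (x + Pi.single i 1) = h x * g x) ∧
      ∀ j ≠ i, (∀ x, g (x + Pi.single j 1) = g x) → ∀ x, h (x + Pi.single j 1) = h x := by
  choose primitive hprimitive using exists_discrete_primitive (G := G)
  refine ⟨fun x => primitive (fun n => g (Function.update x i n)) (x i), fun x => ?_,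
    fun j hj hg x => ?_⟩
  · simp [add_single_eq_update, hprimitive]
  · have hupdate : ∀ n, Function.update (x + Pi.single j 1) i n =
        Function.update x i n + Pi.single j 1 := fun n => by
      rw [add_single_eq_update, add_single_eq_update, Function.update_of_ne hj,
        Function.update_comm hj]
    simp [hupdate, hg, hj.symm]

theorem exists_potential (f : Site d → Fin d → G)
    (hf : ∀ x i j, f x i * f (x + Pi.single i 1) j = f x j * f (x + Pi.single j 1) i) :
    ∃ s : Site d → G, ∀ x i, s (x + Pi.single i 1) = s x * f x i := by
  suffices key : ∀ S : Finset (Fin d), ∃ s : Site d → G, ∀ i ∈ S, ∀ x,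
      s (x + Pi.single i 1) = s x * f x i by
    obtain ⟨s, hs⟩ := key Finset.univ
    exact ⟨s, fun x i => hs i (Finset.mem_univ i) x⟩
  intro S
  induction S using Finset.induction_on with
  | empty => exact ⟨1, by simp⟩
  | insert k S hk ih =>
    obtain ⟨s, hs⟩ := ih
    have hinv : ∀ i ∈ S, ∀ x, f (x + Pi.single i 1) k * s (x + Pi.single i 1) /
        s (x + Pi.single i 1 + Pi.single k 1) = f x k * s x / s (x + Pi.single k 1) := by
      intro i hi x
      rw [add_right_comm, hs i hi, hs i hi, div_eq_div_iff_mul_eq_mul]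
      calc f (x + Pi.single i 1) k * (s x * f x i) * s (x + Pi.single k 1)
          = f x i * f (x + Pi.single i 1) k * (s x * s (x + Pi.single k 1)) := by ac_rfl
        _ = f x k * s x * (s (x + Pi.single k 1) * f (x + Pi.single k 1) i) := by
            rw [hf]; ac_rfl
    obtain ⟨h, hhk, hh⟩ :=
      exists_primitive_along k fun x => f x k * s x / s (x + Pi.single k 1)
    refine ⟨s * h, fun i hi x => ?_⟩
    rw [Pi.mul_apply, Pi.mul_apply]
    rcases Finset.mem_insert.1 hi with rfl | hi
    · rw [hhk, mul_div_assoc', mul_div_cancel]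
      ac_rfl
    · rw [hs i hi, hh i (ne_of_mem_of_not_mem hi hk) (hinv i hi)]
      ac_rfl

end Potential

/-! ### Contour spins -/

/-- The set of sites where the spin of `s` is not `1`. -/
def minusRegion (s : Config d) : Set (Site d) := {x | s x ≠ 1}

theorem notMem_minusRegion {s : Config d} {x : Site d} : x ∉ minusRegion s ↔ s x = 1 := not_not

theorem eq_neg_one_of_mem_minusRegion {s : Config d} {x : Site d} (hx : x ∈ minusRegion s) :
    s x = -1 :=
  (Int.units_eq_one_or _).resolve_left hx

theorem units_mul_eq_one_iff {u v : ℤˣ} : u * v = 1 ↔ u = v := by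
  rw [mul_eq_one_iff_eq_inv, Int.units_inv_eq_self]

/-- The sign changes of `σ` along the edges that start at a point of `γ`. -/
def contourCochain (σ : Config d) (γ : Finset (Site d)) (x y : Site d) : ℤˣ :=
  if x ∈ γ then σ x * σ y else 1

/-- `s` is the spin of the contour `γ` of `σ`: the configuration, equal to `1` at infinity, whose
sign changes are those of `σ` at the points of `γ`. -/
structure IsContourSpin (σ : Config d) (γ : Finset (Site d)) (s : Config d) : Prop where
  mul_eq : ∀ x y, (lattice d).Adj x y → s x * s y = contourCochain σ γ x y
  finite : (minusRegion s).Finite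

namespace IsContourSpin

variable {σ : Config d} {γ : Finset (Site d)} {s : Config d}

theorem eq_of_adj (h : IsContourSpin σ γ s) {x y : Site d} (hxy : (lattice d).Adj x y)
    (hx : x ∉ γ) : s x = s y :=
  units_mul_eq_one_iff.1 ((h.mul_eq x y hxy).trans (if_neg hx))

theorem isLocallyConstantOff (h : IsContourSpin σ γ s) :
    IsLocallyConstantOff (γ : Set (Site d)) s :=
  fun _ _ hxy hx _ => h.eq_of_adj hxy hx

theorem mem_of_ne (h : IsContourSpin σ γ s) {x y : Site d} (hxy : (lattice d).Adj x y)
    (hs : s x ≠ s y) : x ∈ γ :=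
  by_contra fun hx => hs (h.eq_of_adj hxy hx)

theorem minusRegion_subset_volume (h : IsContourSpin σ γ s) :
    minusRegion s ⊆ volume (γ : Set (Site d)) := by
  refine fun x hx => or_iff_not_imp_left.2 fun hxγ => ⟨hxγ, h.finite.subset fun y hy => ?_⟩
  change s y ≠ 1
  rwa [← h.isLocallyConstantOff.eq_of_mem_component hy]

end IsContourSpin

section Existence

variable {σ : Config d} {γ : Finset (Site d)}

theorem mem_iff_of_adj_of_ne (hγ : ∀ x ∈ γ, ∀ y ∈ boundary σ, l1dist x y ≤ 2 → y ∈ γ)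
    {x y : Site d} (hxy : (lattice d).Adj x y) (hσ : σ x ≠ σ y) : x ∈ γ ↔ y ∈ γ := by
  have hxy1 : l1dist x y = 1 := hxy
  exact ⟨fun h => hγ x h y ⟨x, hxy.symm, hσ⟩ (by omega),
    fun h => hγ y h x ⟨y, hxy, hσ.symm⟩ (by rw [l1dist_comm]; omega)⟩

theorem contourCochain_comm (hγ : ∀ x ∈ γ, ∀ y ∈ boundary σ, l1dist x y ≤ 2 → y ∈ γ)
    {x y : Site d} (hxy : (lattice d).Adj x y) :
    contourCochain σ γ x y = contourCochain σ γ y x := by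
  unfold contourCochain
  by_cases hσ : σ x = σ y
  · simp [hσ]
  · simp only [mem_iff_of_adj_of_ne hγ hxy hσ, mul_comm]

theorem contourCochain_eq_mul (hγ : ∀ x ∈ γ, ∀ y ∈ boundary σ, l1dist x y ≤ 2 → y ∈ γ)
    {c x y : Site d} (hc : c ∈ γ) (hcx : l1dist c x ≤ 2) (hxy : (lattice d).Adj x y) :
    contourCochain σ γ x y = σ x * σ y := by
  unfold contourCochain
  by_cases hσ : σ x = σ y
  · simp [hσ]
  · rw [if_pos (hγ c hc x ⟨y, hxy, Ne.symm hσ⟩ hcx)]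

-- Either no corner of the square lies in `γ`, or every corner that starts an edge is within
-- distance `2` of a point of `γ`, and then the cochain is that of `σ` on the whole square.
theorem contourCochain_closed (hγ : ∀ x ∈ γ, ∀ y ∈ boundary σ, l1dist x y ≤ 2 → y ∈ γ)
    (x : Site d) (i j : Fin d) :
    contourCochain σ γ x (x + Pi.single i 1) *
        contourCochain σ γ (x + Pi.single i 1) (x + Pi.single i 1 + Pi.single j 1) =
      contourCochain σ γ x (x + Pi.single j 1) *
        contourCochain σ γ (x + Pi.single j 1) (x + Pi.single j 1 + Pi.single i 1) := by
  let corners : Set (Site d) := {x, x + Pi.single i 1, x + Pi.single j 1}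
  have hx : ∀ u ∈ corners, l1dist x u ≤ 1 := by
    rintro u (rfl | rfl | rfl) <;> simp [l1dist_self, l1dist_add_single]
  have hdist : ∀ c ∈ corners, ∀ u ∈ corners, l1dist c u ≤ 2 := fun c hc u hu => by
    have := hx c hc
    have := hx u hu
    have := l1dist_triangle c x u
    rw [l1dist_comm c x] at this
    omega
  by_cases h : ∃ c ∈ γ, c ∈ corners
  · obtain ⟨c, hcγ, hc⟩ := h
    have hmul : ∀ u ∈ corners, ∀ k, contourCochain σ γ u (u + Pi.single k 1) =
        σ u * σ (u + Pi.single k 1) := fun u hu k =>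
      contourCochain_eq_mul hγ hcγ (hdist c hc u hu) (adj_add_single u k)
    have hcancel : ∀ u v w : ℤˣ, u * v * (v * w) = u * w := fun u v w => by
      rw [mul_assoc, ← mul_assoc v, Int.units_mul_self, one_mul]
    rw [hmul x (by simp [corners]), hmul x (by simp [corners]),
      hmul (x + Pi.single i 1) (by simp [corners]), hmul (x + Pi.single j 1) (by simp [corners]),
      hcancel, hcancel, add_right_comm]
  · have hone : ∀ u ∈ corners, ∀ v, contourCochain σ γ u v = 1 :=
      fun u hu v => if_neg fun huγ => h ⟨u, huγ, hu⟩
    rw [hone x (by simp [corners]), hone x (by simp [corners]),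
      hone (x + Pi.single i 1) (by simp [corners]), hone (x + Pi.single j 1) (by simp [corners])]

theorem exists_contourSpin [Nontrivial (Fin d)]
    (hγ : ∀ x ∈ γ, ∀ y ∈ boundary σ, l1dist x y ≤ 2 → y ∈ γ) : ∃ s, IsContourSpin σ γ s := by
  obtain ⟨s, hs⟩ := exists_potential (fun x i => contourCochain σ γ x (x + Pi.single i 1))
    (contourCochain_closed hγ)
  have hmul : ∀ x y, (lattice d).Adj x y → s x * s y = contourCochain σ γ x y := by
    intro x y hxy
    obtain ⟨i, rfl | rfl⟩ := exists_eq_add_single_of_adj hxy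
    · rw [hs, ← mul_assoc, Int.units_mul_self, one_mul]
    · rw [contourCochain_comm hγ hxy, hs, mul_right_comm, Int.units_mul_self, one_mul]
  have hconst : IsLocallyConstantOff (γ : Set (Site d)) s := fun x y hxy hx _ =>
    units_mul_eq_one_iff.1 ((hmul x y hxy).trans (if_neg hx))
  obtain ⟨c, hc⟩ := hconst.exists_finite_ne γ.finite_toSet
  refine ⟨fun x => s x * c, fun x y hxy => ?_, hc.subset fun x hx hxc => hx ?_⟩
  · rw [mul_mul_mul_comm, Int.units_mul_self, mul_one, hmul x y hxy]
  · simp only [hxc, Int.units_mul_self]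

end Existence

/-! ### Factorisation of a configuration into contour spins -/

namespace IsContourPartition

variable {M a r : ℝ} {σ : Config d} {P : Finset (Finset (Site d))}
  {s : Finset (Site d) → Config d} {γ γ' : Finset (Site d)}

theorem notMem_of_mem (hP : IsContourPartition M a r σ P) (hγ : γ ∈ P) (hγ' : γ' ∈ P)
    (hne : γ ≠ γ') {x : Site d} (hx : x ∈ γ) : x ∉ γ' :=
  Finset.disjoint_left.1 (hP.disjoint γ hγ γ' hγ' hne) hx

theorem two_lt_l1dist (hP : IsContourPartition M a r σ P) (hM : 2 ≤ M) (ha : 0 ≤ a)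
    (hγ : γ ∈ P) (hγ' : γ' ∈ P) (hne : γ ≠ γ') {x y : Site d}
    (hx : x ∈ γ) (hy : y ∈ γ') : 2 < l1dist x y := by
  obtain ⟨pieces, -, hsep⟩ := hP.separated
  have h := hsep γ hγ γ' hγ' hne x hx y hy
  have hone : (1 : ℝ) ≤
      ((max 1 (min (maxDiam (pieces γ)) (maxDiam (pieces γ'))) : ℕ) : ℝ) ^ a :=
    Real.one_le_rpow (by exact_mod_cast le_max_left _ _) ha
  have : (2 : ℝ) < l1dist x y := by nlinarith
  exact_mod_cast this

theorem mem_of_l1dist_le (hP : IsContourPartition M a r σ P) (hM : 2 ≤ M) (ha : 0 ≤ a)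
    (hγ : γ ∈ P) {x y : Site d} (hx : x ∈ γ) (hy : y ∈ boundary σ) (hxy : l1dist x y ≤ 2) :
    y ∈ γ := by
  obtain ⟨γ', hγ', hyγ'⟩ := (hP.cover y).1 hy
  by_cases hne : γ = γ'
  · rwa [hne]
  · exact absurd (hP.two_lt_l1dist hM ha hγ hγ' hne hx hyγ') (by omega)

theorem exists_contourSpins [Nontrivial (Fin d)] (hP : IsContourPartition M a r σ P)
    (hM : 2 ≤ M) (ha : 0 ≤ a) :
    ∃ s : Finset (Site d) → Config d, ∀ γ ∈ P, IsContourSpin σ γ (s γ) := by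
  choose! s hs using fun γ (hγ : γ ∈ P) =>
    exists_contourSpin fun x hx y hy hxy => hP.mem_of_l1dist_le hM ha hγ hx hy hxy
  exact ⟨s, hs⟩

theorem mul_eq_prod_contourCochain (hP : IsContourPartition M a r σ P) {x y : Site d}
    (hxy : (lattice d).Adj x y) : σ x * σ y = ∏ γ ∈ P, contourCochain σ γ x y := by
  unfold contourCochain
  by_cases hx : ∃ γ ∈ P, x ∈ γ
  · obtain ⟨γ, hγ, hxγ⟩ := hx
    rw [Finset.prod_eq_single_of_mem γ hγ fun γ' hγ' hne =>
      if_neg (hP.notMem_of_mem hγ hγ' hne.symm hxγ), if_pos hxγ]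
  · rw [Finset.prod_eq_one fun γ hγ => if_neg fun h => hx ⟨γ, hγ, h⟩, units_mul_eq_one_iff]
    by_contra hne
    exact hx ((hP.cover x).1 ⟨y, hxy, Ne.symm hne⟩)

theorem eq_prod_contourSpin [Nonempty (Fin d)] (hP : IsContourPartition M a r σ P)
    (hs : ∀ γ ∈ P, IsContourSpin σ γ (s γ)) (hσ : (minusRegion σ).Finite) :
    σ = ∏ γ ∈ P, s γ := by
  have hconst : IsLocallyConstantOff ∅ (σ * ∏ γ ∈ P, s γ) := fun x y hxy _ _ => by
    rw [← units_mul_eq_one_iff, Pi.mul_apply, Pi.mul_apply, mul_mul_mul_comm,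
      Finset.prod_apply, Finset.prod_apply, ← Finset.prod_mul_distrib, units_mul_eq_one_iff,
      hP.mul_eq_prod_contourCochain hxy]
    exact Finset.prod_congr rfl fun γ hγ => ((hs γ hγ).mul_eq x y hxy).symm
  have hfin : (minusRegion σ ∪ ⋃ γ ∈ P, minusRegion (s γ)).Finite :=
    hσ.union (Set.Finite.biUnion P.finite_toSet fun γ hγ => (hs γ hγ).finite)
  obtain ⟨z, hz⟩ := hfin.exists_notMem
  simp only [Set.mem_union, Set.mem_iUnion, not_or, not_exists, notMem_minusRegion] at hz
  ext1 x
  rw [← units_mul_eq_one_iff, ← Pi.mul_apply, hconst.eq x z, Pi.mul_apply, hz.1,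
    Finset.prod_apply, Finset.prod_eq_one hz.2, mul_one]

theorem contourSpin_eq (hP : IsContourPartition M a r σ P)
    (hs : ∀ γ ∈ P, IsContourSpin σ γ (s γ)) (hγ : γ ∈ P) (hγ' : γ' ∈ P)
    (hne : γ' ≠ γ) {x y : Site d} (hx : x ∈ γ) (hy : y ∈ γ) : s γ' x = s γ' y := by
  obtain ⟨z, hz⟩ := hP.one_component γ' hγ' γ hγ hne
  have hconst := (hs γ' hγ').isLocallyConstantOff
  exact (hconst.eq_of_mem_component (hz hx)).symm.trans (hconst.eq_of_mem_component (hz hy))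

theorem exists_adj_contourSpin_ne (hP : IsContourPartition M a r σ P)
    (hs : ∀ γ ∈ P, IsContourSpin σ γ (s γ)) (hγ : γ ∈ P) {x : Site d}
    (hx : x ∈ γ) : ∃ y, (lattice d).Adj x y ∧ s γ x ≠ s γ y := by
  obtain ⟨y, hxy, hne⟩ := (hP.cover x).2 ⟨γ, hγ, hx⟩
  refine ⟨y, hxy, fun h => hne (units_mul_eq_one_iff.1 ?_).symm⟩
  rw [← units_mul_eq_one_iff.2 h, (hs γ hγ).mul_eq x y hxy, contourCochain, if_pos hx]

theorem minusRegion_nonempty (hP : IsContourPartition M a r σ P)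
    (hs : ∀ γ ∈ P, IsContourSpin σ γ (s γ)) (hγ : γ ∈ P) : (minusRegion (s γ)).Nonempty := by
  obtain ⟨x, hx⟩ := hP.nonempty γ hγ
  obtain ⟨y, -, hne⟩ := hP.exists_adj_contourSpin_ne hs hγ hx
  by_contra! h
  simp only [Set.eq_empty_iff_forall_notMem, notMem_minusRegion] at h
  exact hne ((h x).trans (h y).symm)

variable [Nonempty (Fin d)]

theorem eq_mul_prod_erase (hP : IsContourPartition M a r σ P)
    (hs : ∀ γ ∈ P, IsContourSpin σ γ (s γ)) (hσ : (minusRegion σ).Finite)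
    (hγ : γ ∈ P) {x y z : Site d} (hx : x ∈ γ) (hxy : (lattice d).Adj x y) (hz : z ∈ γ) :
    σ y = s γ y * ∏ γ' ∈ P.erase γ, s γ' z := by
  conv_lhs => rw [hP.eq_prod_contourSpin hs hσ, Finset.prod_apply, ← Finset.mul_prod_erase P _ hγ]
  congr 1
  refine Finset.prod_congr rfl fun γ' hγ' => ?_
  obtain ⟨hne, hγ'⟩ := Finset.mem_erase.1 hγ'
  rw [← (hs γ' hγ').eq_of_adj hxy (hP.notMem_of_mem hγ hγ' hne.symm hx)]
  exact hP.contourSpin_eq hs hγ hγ' hne hx hz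

theorem prod_erase_eq_one (hP : IsContourPartition M a r σ P)
    (hs : ∀ γ ∈ P, IsContourSpin σ γ (s γ)) (hσ : (minusRegion σ).Finite)
    (hγ : γ ∈ P) (hlabel : HasLabel σ γ 1) {z : Site d} (hz : z ∈ γ) :
    ∏ γ' ∈ P.erase γ, s γ' z = 1 := by
  obtain ⟨x, hx, y, hy, hxy⟩ := exists_boundary_edge_volume ⟨z, hz⟩ γ.finite_toSet
  have h := hP.eq_mul_prod_erase hs hσ hγ hx hxy hz
  rwa [hlabel y ⟨hy, x, Or.inl hx, hxy.symm⟩,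
    notMem_minusRegion.1 fun h => hy ((hs γ hγ).minusRegion_subset_volume h), one_mul,
    eq_comm] at h

theorem eq_contourSpin_of_adj (hP : IsContourPartition M a r σ P)
    (hs : ∀ γ ∈ P, IsContourSpin σ γ (s γ)) (hσ : (minusRegion σ).Finite)
    (hγ : γ ∈ P) (hlabel : HasLabel σ γ 1) {x y : Site d} (hx : x ∈ γ)
    (hxy : (lattice d).Adj x y) : σ y = s γ y := by
  rw [hP.eq_mul_prod_erase hs hσ hγ hx hxy hx, hP.prod_erase_eq_one hs hσ hγ hlabel hx, mul_one]

theorem labelledInside_neg_one_eq (hP : IsContourPartition M a r σ P)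
    (hs : ∀ γ ∈ P, IsContourSpin σ γ (s γ)) (hσ : (minusRegion σ).Finite)
    (hγ : γ ∈ P) (hlabel : HasLabel σ γ 1) :
    labelledInside σ γ (-1) = minusRegion (s γ) \ γ := by
  have hboundary : ∀ x, ∀ y ∈ innerBoundary (volume (component ((γ : Set (Site d))ᶜ) x)),
      σ y = s γ x := by
    rintro x y ⟨hy, z, hz, hyz⟩
    have hyC := mem_of_adj_of_mem_volume hy hz hyz
    have hzγ : z ∈ γ := by_contra fun hzγ => hz (Or.inl (mem_component_of_adj hyC hzγ hyz))
    rw [hP.eq_contourSpin_of_adj hs hσ hγ hlabel hzγ hyz.symm]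
    exact ((hs γ hγ).isLocallyConstantOff.eq_of_mem_component hyC).symm
  ext x
  constructor
  · rintro ⟨hx, hminus⟩
    obtain ⟨y, hy, z, hz, hyz⟩ :=
      exists_boundary_edge_volume ⟨x, mem_component_self hx.1⟩ hx.2
    have hyB : y ∈ innerBoundary (volume (component ((γ : Set (Site d))ᶜ) x)) :=
      ⟨Or.inl hy, z, hz, hyz⟩
    refine ⟨fun hone => ?_, hx.1⟩
    rw [← hboundary x y hyB, hminus y hyB] at hone
    exact absurd hone (by decide)
  · rintro ⟨hx, hxγ⟩
    refine ⟨((hs γ hγ).minusRegion_subset_volume hx).resolve_left hxγ, fun y hy => ?_⟩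
    rw [hboundary x y hy, eq_neg_one_of_mem_minusRegion hx]

end IsContourPartition

namespace IsExternalFamily

variable {M a r : ℝ} {σ : Config d} {Λ : Finset (Site d)} {P Γ : Finset (Finset (Site d))}
  {s : Finset (Site d) → Config d} {γ γ' : Finset (Site d)}

theorem contourSpin_eq_one_of_mem {c : ℤˣ} (hΓ : IsExternalFamily Λ σ P Γ c)
    (hP : IsContourPartition M a r σ P) (hs : ∀ γ ∈ P, IsContourSpin σ γ (s γ))
    (hγ : γ ∈ Γ) (hγ' : γ' ∈ Γ) (hne : γ' ≠ γ) {x : Site d} (hx : x ∈ γ) : s γ' x = 1 := by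
  obtain ⟨y, hy, hyV⟩ := Set.not_subset.1 (hΓ.external γ hγ γ' hγ' hne.symm)
  rw [hP.contourSpin_eq hs (hΓ.subset hγ) (hΓ.subset hγ') hne hx hy]
  exact notMem_minusRegion.1 fun h => hyV ((hs γ' (hΓ.subset hγ')).minusRegion_subset_volume h)

variable [Nonempty (Fin d)]

-- An edge leaving the intersection of the two regions starts at a point of one of the contours.
theorem disjoint_minusRegion {c : ℤˣ} (hΓ : IsExternalFamily Λ σ P Γ c)
    (hP : IsContourPartition M a r σ P) (hs : ∀ γ ∈ P, IsContourSpin σ γ (s γ))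
    (hγ : γ ∈ Γ) (hγ' : γ' ∈ Γ) (hne : γ' ≠ γ) :
    Disjoint (minusRegion (s γ)) (minusRegion (s γ')) := by
  have hsγ := hs γ (hΓ.subset hγ)
  have hsγ' := hs γ' (hΓ.subset hγ')
  rw [Set.disjoint_iff_inter_eq_empty, ← Set.not_nonempty_iff_eq_empty]
  intro hmeet
  obtain ⟨u, hu, v, hv, huv⟩ := exists_boundary_edge hmeet
    fun h => Set.infinite_univ (h ▸ hsγ.finite.subset Set.inter_subset_left)
  by_cases hv1 : s γ v = 1
  · have huγ : u ∈ γ := hsγ.mem_of_ne huv (by rw [hv1]; exact hu.1)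
    exact hu.2 (hΓ.contourSpin_eq_one_of_mem hP hs hγ hγ' hne huγ)
  · have hv2 : s γ' v = 1 := by_contra fun h => hv ⟨hv1, h⟩
    have huγ : u ∈ γ' := hsγ'.mem_of_ne huv (by rw [hv2]; exact hu.2)
    exact hu.1 (hΓ.contourSpin_eq_one_of_mem hP hs hγ' hγ hne.symm huγ)

theorem minusRegion_prod {c : ℤˣ} (hΓ : IsExternalFamily Λ σ P Γ c)
    (hP : IsContourPartition M a r σ P) (hs : ∀ γ ∈ P, IsContourSpin σ γ (s γ)) :
    minusRegion (∏ γ ∈ Γ, s γ) = ⋃ γ ∈ Γ, minusRegion (s γ) := by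
  ext x
  simp only [Set.mem_iUnion, exists_prop]
  by_cases h : ∃ γ ∈ Γ, x ∈ minusRegion (s γ)
  · refine iff_of_true ?_ h
    obtain ⟨γ, hγ, hx⟩ := h
    rw [minusRegion, Set.mem_ofPred_eq, Finset.prod_apply,
      Finset.prod_eq_single_of_mem γ hγ fun γ' hγ' hne => notMem_minusRegion.1
        (Set.disjoint_left.1 (hΓ.disjoint_minusRegion hP hs hγ hγ' hne) hx)]
    exact hx
  · refine iff_of_false (notMem_minusRegion.2 ?_) h
    push Not at h
    rw [Finset.prod_apply, Finset.prod_eq_one fun γ hγ => notMem_minusRegion.1 (h γ hγ)]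

theorem contourFlip_eq_mul (hΓ : IsExternalFamily Λ σ P Γ 1)
    (hP : IsContourPartition M a r σ P) (hs : ∀ γ ∈ P, IsContourSpin σ γ (s γ))
    (hσ : (minusRegion σ).Finite) : contourFlip Γ σ = σ * ∏ γ ∈ Γ, s γ := by
  have hinside : ∀ γ ∈ Γ, labelledInside σ γ (-1) = minusRegion (s γ) \ γ := fun γ hγ =>
    hP.labelledInside_neg_one_eq hs hσ (hΓ.subset hγ) (hΓ.label γ hγ)
  ext1 x
  rw [contourFlip, Pi.mul_apply, Finset.prod_apply]
  split_ifs with hsupport hminus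
  · obtain ⟨γ, hγ, hx⟩ := hsupport
    rw [Finset.prod_eq_single_of_mem γ hγ fun γ' hγ' hne =>
      hΓ.contourSpin_eq_one_of_mem hP hs hγ hγ' hne hx, hP.eq_prod_contourSpin hs hσ,
      Finset.prod_apply, ← Finset.mul_prod_erase P _ (hΓ.subset hγ),
      hP.prod_erase_eq_one hs hσ (hΓ.subset hγ) (hΓ.label γ hγ) hx, mul_one, Int.units_mul_self]
  · obtain ⟨γ, hγ, hx⟩ := hminus
    rw [hinside γ hγ] at hx
    rw [Finset.prod_eq_single_of_mem γ hγ fun γ' hγ' hne => notMem_minusRegion.1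
        (Set.disjoint_left.1 (hΓ.disjoint_minusRegion hP hs hγ hγ' hne) hx.1),
      eq_neg_one_of_mem_minusRegion hx.1, mul_neg_one]
  · rw [Finset.prod_eq_one, mul_one]
    refine fun γ hγ => notMem_minusRegion.1 fun hx => hminus ⟨γ, hγ, ?_⟩
    rw [hinside γ hγ]
    exact ⟨hx, fun hxγ => hsupport ⟨γ, hγ, hxγ⟩⟩

end IsExternalFamily

/-! ### The size of a contour and of its negative region -/

theorem l1dist_le_maxDiam {F : Finset (Finset (Site d))} {A : Finset (Site d)} (hA : A ∈ F)
    {x y : Site d} (hx : x ∈ A) (hy : y ∈ A) : l1dist x y ≤ maxDiam F :=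
  (Finset.le_sup (f := fun p : Site d × Site d => l1dist p.1 p.2)
    (Finset.mk_mem_product hx hy)).trans (Finset.le_sup (f := diam) hA)

theorem card_image_eval_le (F : Finset (Finset (Site d))) (i : Fin d) :
    ((F.sup id).image fun x => x i).card ≤ F.card * (maxDiam F + 1) := by
  have hsub : (F.sup id).image (fun x => x i) ⊆ F.biUnion fun A => A.image fun x => x i := by
    simp only [Finset.subset_iff, Finset.mem_image, Finset.mem_sup, Finset.mem_biUnion]
    rintro t ⟨x, ⟨A, hA, hxA⟩, rfl⟩
    exact ⟨A, hA, x, hxA, rfl⟩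
  refine (Finset.card_le_card hsub).trans (Finset.card_biUnion_le_card_mul _ _ _ fun A hA => ?_)
  rcases A.eq_empty_or_nonempty with rfl | hne
  · simp
  obtain ⟨p, hp, hmin⟩ := A.exists_min_image (· i) hne
  have hIcc : A.image (fun x => x i) ⊆ Finset.Icc (p i) (p i + maxDiam F) := by
    intro t ht
    obtain ⟨q, hq, rfl⟩ := Finset.mem_image.1 ht
    have hpq := hmin q hq
    have hcoord := natAbs_sub_le_l1dist p q i
    have hdiam := l1dist_le_maxDiam hA hp hq
    rw [Finset.mem_Icc]
    omega
  refine (Finset.card_le_card hIcc).trans ?_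
  rw [Int.card_Icc]
  omega

theorem exists_le_forall_eval_ne (F : Finset (Finset (Site d))) (i : Fin d) (u : ℤ) :
    ∃ t ≤ F.card * (maxDiam F + 1), ∀ z ∈ F.sup id, z i ≠ u + t := by
  set m := F.card * (maxDiam F + 1)
  have hinj : Function.Injective fun t : ℕ => u + (t : ℤ) := fun t t' htt => by simpa using htt
  have hcard : ((F.sup id).image fun z => z i).card <
      ((Finset.range (m + 1)).image fun t : ℕ => u + (t : ℤ)).card := by
    rw [Finset.card_image_of_injective _ hinj, Finset.card_range]
    exact Nat.lt_succ_of_le (card_image_eval_le F i)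
  obtain ⟨v, hv, hvF⟩ := Finset.exists_mem_notMem_of_card_lt_card hcard
  obtain ⟨t, ht, rfl⟩ := Finset.mem_image.1 hv
  exact ⟨t, Finset.mem_range_succ_iff.1 ht, fun z hz h => hvF (Finset.mem_image.2 ⟨z, hz, h⟩)⟩

theorem card_le_of_forall_l1dist_le {A : Finset (Site d)} {p : Site d} {R : ℕ}
    (hA : ∀ x ∈ A, l1dist x p ≤ R) : A.card ≤ (2 * R + 1) ^ d := by
  have hbox : A ⊆ Finset.Icc (fun i => p i - R) (fun i => p i + R) := by
    intro x hx
    have hR := hA x hx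
    rw [Finset.mem_Icc]
    constructor <;> intro i <;> have := natAbs_sub_le_l1dist x p i <;> beta_reduce <;> omega
  refine (Finset.card_le_card hbox).trans ?_
  rw [Pi.card_Icc, Finset.prod_congr rfl fun i _ => show _ = 2 * R + 1 by rw [Int.card_Icc]; omega]
  simp

namespace IsContourSpin

variable [Nontrivial (Fin d)] {σ : Config d} {γ : Finset (Site d)} {s : Config d}
  {F : Finset (Finset (Site d))}

-- A short segment from `x` in one direction reaches a hyperplane that avoids `γ`; the spin is
-- constant along that hyperplane.
theorem exists_l1dist_le (h : IsContourSpin σ γ s) (hF : F.sup id = γ) {x : Site d}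
    (hx : x ∈ minusRegion s) : ∃ p ∈ γ, l1dist x p ≤ F.card * (maxDiam F + 1) := by
  by_contra! hfar
  let i : Fin d := Classical.arbitrary _
  obtain ⟨j, hij⟩ := exists_ne i
  obtain ⟨t, htm, htγ⟩ := exists_le_forall_eval_ne F i (x i)
  rw [hF] at htγ
  set y := Function.update x i (x i + t) with hy
  have hxy : s x = s y := by
    have hdist : l1dist x y = t := by
      rw [hy, ← add_single_eq_update, l1dist_add_single, Int.natAbs_natCast]
    exact h.isLocallyConstantOff.eq_of_l1ball x y fun z hz hzγ => by
      have := hfar z hzγ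
      omega
  refine infinite_of_forall_update_mem (A := minusRegion s) y j (fun u => ?_) h.finite
  have hline : s y = s (Function.update y j (y j + u)) := by
    refine h.isLocallyConstantOff.eq_of_hyperplane y _ i (by rw [Function.update_of_ne hij.symm])
      fun z hz hzγ => htγ z hzγ ?_
    rwa [hy, Function.update_self] at hz
  rwa [minusRegion, Set.mem_ofPred_eq, ← hline, ← hxy]

theorem ncard_minusRegion_le (h : IsContourSpin σ γ s) (hF : F.sup id = γ) :
    (minusRegion s).ncard ≤
      F.card * (2 * (maxDiam F + F.card * (maxDiam F + 1)) + 1) ^ d := by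
  classical
  set m := F.card * (maxDiam F + 1)
  set N := h.finite.toFinset
  rw [Set.ncard_eq_toFinset_card _ h.finite]
  have hsub : N ⊆ F.biUnion fun A => N.filter fun x => ∃ p ∈ A, l1dist x p ≤ m := by
    intro x hx
    obtain ⟨p, hp, hxp⟩ := h.exists_l1dist_le hF (h.finite.mem_toFinset.1 hx)
    rw [← hF] at hp
    obtain ⟨A, hA, hpA⟩ := Finset.mem_sup.1 hp
    exact Finset.mem_biUnion.2 ⟨A, hA, Finset.mem_filter.2 ⟨hx, p, hpA, hxp⟩⟩
  refine (Finset.card_le_card hsub).trans (Finset.card_biUnion_le_card_mul _ _ _ fun A hA => ?_)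
  rcases A.eq_empty_or_nonempty with rfl | ⟨q, hq⟩
  · simp
  refine card_le_of_forall_l1dist_le (p := q) fun x hx => ?_
  obtain ⟨-, p, hp, hxp⟩ := Finset.mem_filter.1 hx
  have htri := l1dist_triangle x p q
  have hdiam := l1dist_le_maxDiam hA hp hq
  omega

end IsContourSpin

open MeasureTheory
open scoped ENNReal

/-! ### The interaction as a measure on pairs of sites -/

theorem l1dist_eq_zero {x y : Site d} : l1dist x y = 0 ↔ x = y := by
  simp [l1dist, Finset.sum_eq_zero_iff, funext_iff, sub_eq_zero]

theorem coupling_nonneg {J : ℝ} (hJ : 0 ≤ J) (α : ℝ) (x y : Site d) : 0 ≤ coupling J α x y := by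
  unfold coupling
  split_ifs
  · exact le_rfl
  · positivity

theorem coupling_comm (J α : ℝ) (x y : Site d) : coupling J α x y = coupling J α y x := by
  unfold coupling
  rw [l1dist_comm x y]
  simp only [eq_comm]

theorem coupling_of_adj (J α : ℝ) {x y : Site d} (h : (lattice d).Adj x y) :
    coupling J α x y = J := by
  have h1 : l1dist x y = 1 := h
  rw [coupling, if_neg h.ne, h1]
  simp

theorem coupling_eq {α : ℝ} (hα : α ≠ 0) (J : ℝ) (x y : Site d) :
    coupling J α x y = J * (l1dist x y : ℝ) ^ (-α) := by
  unfold coupling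
  split_ifs with h
  · rw [l1dist_eq_zero.2 h, Nat.cast_zero, Real.zero_rpow (neg_ne_zero.2 hα), mul_zero]
  · rfl

theorem norm_le_l1dist (x : Site d) : ‖(fun i => (x i : ℝ) : Fin d → ℝ)‖ ≤ l1dist x 0 := by
  refine (pi_norm_le_iff_of_nonneg (Nat.cast_nonneg _)).2 fun i => ?_
  have h := natAbs_sub_le_l1dist x 0 i
  rw [Pi.zero_apply, sub_zero] at h
  rw [Real.norm_eq_abs, ← Int.cast_abs, Int.abs_eq_natAbs, Int.cast_natCast]
  exact_mod_cast h

theorem summable_l1dist_rpow {β : ℝ} (hβ : (d : ℝ) < β) :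
    Summable fun x : Site d => (l1dist x 0 : ℝ) ^ (-β) := by
  have : 0 < β := lt_of_le_of_lt (Nat.cast_nonneg d) hβ
  set L : Submodule ℤ (Fin d → ℝ) := Submodule.span ℤ (Set.range (Pi.basisFun ℝ (Fin d)))
  have hrank : Module.finrank ℤ L = d := by
    rw [ZLattice.rank ℝ L]; simp
  have hmem : ∀ x : Site d, (fun i => (x i : ℝ)) ∈ L := fun x => by
    rw [Module.Basis.mem_span_iff_repr_mem]
    exact fun i => ⟨x i, by simp⟩
  let φ : Site d → L := fun x => ⟨fun i => (x i : ℝ), hmem x⟩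
  have hφ : Function.Injective φ := fun x y h => funext fun i => by
    have hi : (x i : ℝ) = y i := congrFun (congrArg Subtype.val h) i
    exact_mod_cast hi
  have hsum := (ZLattice.summable_norm_rpow L (-β) (by rw [hrank]; linarith)).comp_injective hφ
  refine hsum.of_nonneg_of_le (fun _ => by positivity) fun x => ?_
  rcases eq_or_ne x 0 with rfl | hx
  · rw [l1dist_self, Nat.cast_zero, Real.zero_rpow (by linarith)]
    exact Real.rpow_nonneg (norm_nonneg _) _
  · have hφx : φ x ≠ 0 := fun h => hx (hφ (h.trans (by ext; simp [φ])))
    exact Real.rpow_le_rpow_of_nonpos (norm_pos_iff.2 hφx) (norm_le_l1dist x) (by linarith)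

/-- The sum of `|x - y|^{-β}` over all sites `y` other than a fixed `x`, for `β ≠ 0`. -/
noncomputable def latticeSum (d : ℕ) (β : ℝ) : ℝ := ∑' x : Site d, (l1dist x 0 : ℝ) ^ (-β)

theorem latticeSum_nonneg (d : ℕ) (β : ℝ) : 0 ≤ latticeSum d β :=
  tsum_nonneg fun _ => by positivity

theorem tsum_ofReal_l1dist_rpow {β : ℝ} (hβ : (d : ℝ) < β) (x : Site d) :
    ∑' y, ENNReal.ofReal ((l1dist x y : ℝ) ^ (-β)) = ENNReal.ofReal (latticeSum d β) := by
  rw [latticeSum, ENNReal.ofReal_tsum_of_nonneg (fun _ => by positivity) (summable_l1dist_rpow hβ),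
    ← (Equiv.addRight x).tsum_eq fun y => ENNReal.ofReal ((l1dist x y : ℝ) ^ (-β))]
  refine tsum_congr fun y => ?_
  have hxy : l1dist x (y + x) = l1dist y 0 := by
    rw [l1dist_comm]
    simp [l1dist]
  rw [Equiv.coe_addRight, hxy]

/-- The measure on the sites with mass `J_{x,y}` at `y`, for a fixed site `x`. -/
noncomputable def siteInteraction (J α : ℝ) (x : Site d) : Measure (Site d) :=
  Measure.count.withDensity fun y => ENNReal.ofReal (coupling J α x y)

/-- The measure on the pairs of sites with mass `J_{x,y}` at `(x, y)`; the measure of a set of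
pairs is their total interaction. -/
noncomputable def interaction (J α : ℝ) : Measure (Site d × Site d) :=
  Measure.sum fun x => (siteInteraction J α x).map (Prod.mk x)

theorem siteInteraction_apply (J α : ℝ) (x : Site d) (S : Set (Site d)) :
    siteInteraction J α x S = ∑' y, S.indicator (fun y => ENNReal.ofReal (coupling J α x y)) y := by
  rw [siteInteraction, withDensity_apply _ (.of_discrete), ← lintegral_indicator (.of_discrete),
    lintegral_count]

theorem interaction_apply (J α : ℝ) (S : Set (Site d × Site d)) :
    interaction J α S = ∑' x, siteInteraction J α x (Prod.mk x ⁻¹' S) := by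
  rw [interaction, Measure.sum_apply _ (.of_discrete)]
  exact tsum_congr fun x => Measure.map_apply (.of_discrete) (.of_discrete)

section SiteInteraction

variable {J α : ℝ}

theorem siteInteraction_univ (hα : (d : ℝ) < α) (hJ : 0 ≤ J) (x : Site d) :
    siteInteraction J α x Set.univ = ENNReal.ofReal (J * latticeSum d α) := by
  have hα0 : α ≠ 0 := (lt_of_le_of_lt (Nat.cast_nonneg d) hα).ne'
  simp only [siteInteraction_apply, Set.indicator_univ, coupling_eq hα0, ENNReal.ofReal_mul hJ]
  rw [ENNReal.tsum_mul_left, tsum_ofReal_l1dist_rpow hα]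

theorem siteInteraction_le_of_forall_le {β R : ℝ} (hβ : (d : ℝ) < β) (hβα : β ≤ α) (hJ : 0 ≤ J)
    (hR : 0 < R) {x : Site d} {S : Set (Site d)} (hS : ∀ y ∈ S, R ≤ l1dist x y) :
    siteInteraction J α x S ≤ ENNReal.ofReal (J * R ^ (β - α) * latticeSum d β) := by
  have hα0 : α ≠ 0 := (lt_of_le_of_lt (Nat.cast_nonneg d) (hβ.trans_le hβα)).ne'
  have h0 : 0 ≤ J * R ^ (β - α) := by positivity
  rw [siteInteraction_apply, ENNReal.ofReal_mul h0, ← tsum_ofReal_l1dist_rpow hβ x,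
    ← ENNReal.tsum_mul_left]
  refine ENNReal.tsum_le_tsum fun y => Set.indicator_apply_le' (fun hy => ?_) fun _ => zero_le
  have hpos : (0 : ℝ) < l1dist x y := hR.trans_le (hS y hy)
  rw [← ENNReal.ofReal_mul h0]
  refine ENNReal.ofReal_le_ofReal ?_
  calc coupling J α x y = J * ((l1dist x y : ℝ) ^ (β - α) * (l1dist x y : ℝ) ^ (-β)) := by
        rw [coupling_eq hα0, ← Real.rpow_add hpos, sub_add_eq_add_sub, add_neg_cancel, zero_sub]
    _ ≤ J * (R ^ (β - α) * (l1dist x y : ℝ) ^ (-β)) := by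
        gcongr J * (?_ * _)
        exact Real.rpow_le_rpow_of_nonpos hR (hS y hy) (by linarith)
    _ = J * R ^ (β - α) * (l1dist x y : ℝ) ^ (-β) := by ring

theorem coupling_le_of_l1dist_le (hJ : 0 ≤ J) (hα : 0 < α) {z u w : Site d} (huw : u ≠ w)
    (h : l1dist z u ≤ l1dist z w) : coupling J α z w ≤ 2 ^ α * coupling J α u w := by
  have hpos : (0 : ℝ) < l1dist u w :=
    Nat.cast_pos.2 (Nat.pos_of_ne_zero fun h0 => huw (l1dist_eq_zero.1 h0))
  have hle : (l1dist u w : ℝ) ≤ 2 * l1dist z w := by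
    have htri := l1dist_triangle u z w
    rw [l1dist_comm u z] at htri
    exact_mod_cast (by omega : l1dist u w ≤ 2 * l1dist z w)
  have hpow : (2 * (l1dist z w : ℝ)) ^ (-α) ≤ (l1dist u w : ℝ) ^ (-α) :=
    Real.rpow_le_rpow_of_nonpos hpos hle (by linarith)
  rw [Real.mul_rpow (by norm_num) (Nat.cast_nonneg _), Real.rpow_neg (by norm_num),
    inv_mul_le_iff₀ (by positivity)] at hpow
  rw [coupling_eq hα.ne', coupling_eq hα.ne', mul_left_comm]
  exact mul_le_mul_of_nonneg_left hpow hJ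

theorem siteInteraction_le_of_l1dist_le (hJ : 0 ≤ J) (hα : 0 < α) {z u : Site d}
    {S : Set (Site d)} (hu : u ∉ S) (h : ∀ w ∈ S, l1dist z u ≤ l1dist z w) :
    siteInteraction J α z S ≤ ENNReal.ofReal (2 ^ α) * siteInteraction J α u S := by
  rw [siteInteraction_apply, siteInteraction_apply, ← ENNReal.tsum_mul_left]
  refine ENNReal.tsum_le_tsum fun w => Set.indicator_apply_le' (fun hw => ?_) fun _ => zero_le
  rw [Set.indicator_of_mem hw, ← ENNReal.ofReal_mul (by positivity)]
  exact ENNReal.ofReal_le_ofReal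
    (coupling_le_of_l1dist_le hJ hα (fun e => hu (e ▸ hw)) (h w hw))

theorem ofReal_le_siteInteraction {x y : Site d} (hxy : (lattice d).Adj x y) {S : Set (Site d)}
    (hy : y ∈ S) : ENNReal.ofReal J ≤ siteInteraction J α x S := by
  calc ENNReal.ofReal J
      = S.indicator (fun y => ENNReal.ofReal (coupling J α x y)) y := by
        rw [Set.indicator_of_mem hy, coupling_of_adj J α hxy]
    _ ≤ siteInteraction J α x S := by
        rw [siteInteraction_apply]
        exact ENNReal.le_tsum y

end SiteInteraction

section Interaction

variable {J α : ℝ} {S : Set (Site d × Site d)}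

theorem interaction_preimage_swap (S : Set (Site d × Site d)) :
    interaction J α (Prod.swap ⁻¹' S) = interaction J α S := by
  classical
  simp only [interaction_apply, siteInteraction_apply]
  rw [ENNReal.tsum_comm]
  refine tsum_congr fun y => tsum_congr fun x => ?_
  simp only [Set.indicator_apply, Set.mem_preimage, Prod.swap_prod_mk, coupling_comm J α x y]

theorem siteInteraction_le_interaction (x : Site d) :
    siteInteraction J α x (Prod.mk x ⁻¹' S) ≤ interaction J α S := by
  rw [interaction_apply]
  exact ENNReal.le_tsum x

theorem interaction_le_ncard_mul {N : Set (Site d)} (hN : N.Finite) (hS : ∀ p ∈ S, p.1 ∈ N)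
    {c : ℝ≥0∞} (hc : ∀ x ∈ N, siteInteraction J α x (Prod.mk x ⁻¹' S) ≤ c) :
    interaction J α S ≤ N.ncard * c := by
  have hempty : ∀ x ∉ hN.toFinset, siteInteraction J α x (Prod.mk x ⁻¹' S) = 0 := fun x hx => by
    have hrow : Prod.mk x ⁻¹' S = ∅ :=
      Set.eq_empty_of_forall_notMem fun y hy => hx (hN.mem_toFinset.2 (hS (x, y) hy))
    rw [hrow, measure_empty]
  rw [interaction_apply, tsum_eq_sum hempty, Set.ncard_eq_toFinset_card _ hN, ← nsmul_eq_mul]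
  exact Finset.sum_le_card_nsmul _ _ _ fun x hx => hc x (hN.mem_toFinset.1 hx)

theorem card_mul_le_interaction {C : Finset (Site d)} {b c : ℝ≥0∞}
    (hc : ∀ x ∈ C, c ≤ b * siteInteraction J α x (Prod.mk x ⁻¹' S)) :
    C.card * c ≤ b * interaction J α S := by
  rw [interaction_apply, ← nsmul_eq_mul]
  refine (Finset.card_nsmul_le_sum _ _ _ hc).trans ?_
  rw [← Finset.mul_sum]
  gcongr
  exact ENNReal.sum_le_tsum C

theorem interaction_le_ncard (hα : (d : ℝ) < α) (hJ : 0 ≤ J) {N : Set (Site d)} (hN : N.Finite)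
    (hS : ∀ p ∈ S, p.1 ∈ N) :
    interaction J α S ≤ N.ncard * ENNReal.ofReal (J * latticeSum d α) :=
  interaction_le_ncard_mul hN hS fun x _ =>
    (measure_mono (Set.subset_univ _)).trans_eq (siteInteraction_univ hα hJ x)

theorem interaction_ne_top (hα : (d : ℝ) < α) (hJ : 0 ≤ J) {N : Set (Site d)} (hN : N.Finite)
    (hS : ∀ p ∈ S, p.1 ∈ N) : interaction J α S ≠ ∞ :=
  ne_top_of_le_ne_top (by finiteness) (interaction_le_ncard hα hJ hN hS)

/-- The ordered pairs of sites whose first member alone lies in `A`; their interaction is `F_A`. -/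
def cut (A : Set (Site d)) : Set (Site d × Site d) := A ×ˢ Aᶜ

theorem surfaceEnergy_eq (hα : (d : ℝ) < α) (hJ : 0 ≤ J) (A : Set (Site d)) :
    surfaceEnergy J α A = (interaction J α).real (cut A) := by
  classical
  have hrow : ∀ x : Site d, ∑' y : (Aᶜ : Set (Site d)), coupling J α x y =
      (siteInteraction J α x Aᶜ).toReal := fun x => by
    rw [siteInteraction_apply, ← tsum_subtype,
      ENNReal.tsum_toReal_eq fun _ => ENNReal.ofReal_ne_top]
    exact tsum_congr fun y => (ENNReal.toReal_ofReal (coupling_nonneg hJ α x y)).symm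
  have hfin : ∀ x : Site d, siteInteraction J α x Aᶜ ≠ ∞ := fun x =>
    measure_ne_top_of_subset (Set.subset_univ _) (by rw [siteInteraction_univ hα hJ]; finiteness)
  rw [surfaceEnergy, cut, Measure.real, interaction_apply]
  simp only [hrow]
  rw [← ENNReal.tsum_toReal_eq fun x : A => hfin x,
    tsum_subtype A fun x => siteInteraction J α x Aᶜ]
  congr 1
  refine tsum_congr fun x => ?_
  by_cases hx : x ∈ A
  · rw [Set.indicator_of_mem hx, Set.mk_preimage_prod_right hx]
  · rw [Set.indicator_of_notMem hx, Set.mk_preimage_prod_right_eq_empty hx, measure_empty]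

/-- The ordered pairs of sites at which `s` takes different values. -/
def changeSet (s : Config d) : Set (Site d × Site d) := {p | s p.1 ≠ s p.2}

theorem changeSet_eq_union (s : Config d) :
    changeSet s = cut (minusRegion s) ∪ Prod.swap ⁻¹' cut (minusRegion s) := by
  ext ⟨x, y⟩
  rcases Int.units_eq_one_or (s x) with hx | hx <;>
    rcases Int.units_eq_one_or (s y) with hy | hy <;> simp [changeSet, cut, minusRegion, hx, hy]

theorem interaction_changeSet_le (s : Config d) :
    interaction J α (changeSet s) ≤ 2 * interaction J α (cut (minusRegion s)) := by
  rw [changeSet_eq_union, two_mul]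
  exact (measure_union_le _ _).trans_eq (by rw [interaction_preimage_swap])

end Interaction

/-! ### Pairs of sites separated by two contour spins -/

/-- The sites at distance at most `R` from `N`. -/
def l1thickening (R : ℝ) (N : Set (Site d)) : Set (Site d) := {u | ∃ z ∈ N, (l1dist z u : ℝ) ≤ R}

theorem exists_finset_forall_l1dist_le (z : Site d) (m : ℕ) :
    ∃ C : Finset (Site d), C.card = (m + 1) ^ d ∧ ∀ u ∈ C, l1dist z u ≤ d * m := by
  refine ⟨Finset.Icc z fun i => z i + m, ?_, fun u hu => ?_⟩
  · rw [Pi.card_Icc, Finset.prod_congr rfl fun i _ => show _ = m + 1 by rw [Int.card_Icc]; omega]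
    simp
  · obtain ⟨hzu, huz⟩ := Finset.mem_Icc.1 hu
    refine (Finset.sum_le_card_nsmul _ _ m fun i _ => ?_).trans_eq (by simp)
    have hlow : z i ≤ u i := hzu i
    have hhigh : u i ≤ z i + m := huz i
    omega

section Average

variable {J α R : ℝ} {s : Config d} {N : Set (Site d)}

-- `s` is constant on a cube with a corner at `z`, and each site of the cube interacts with the
-- sites of the opposite spin at least as much as `z` does, up to the factor `2 ^ α`.
theorem pow_mul_siteInteraction_changeSet_le (hJ : 0 ≤ J) (hα : 0 < α) (hR : 0 ≤ R) {z : Site d}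
    (hz : z ∈ N) (hs : ∀ w, s z ≠ s w → R < l1dist z w) :
    (⌊R / d⌋₊ + 1 : ℝ≥0∞) ^ d * siteInteraction J α z (Prod.mk z ⁻¹' changeSet s) ≤
      ENNReal.ofReal (2 ^ α) * interaction J α (changeSet s ∩ Prod.fst ⁻¹' l1thickening R N) := by
  obtain ⟨C, hCcard, hC⟩ := exists_finset_forall_l1dist_le z ⌊R / d⌋₊
  have hCR : ∀ u ∈ C, (l1dist z u : ℝ) ≤ R := fun u hu =>
    calc (l1dist z u : ℝ) ≤ d * ⌊R / d⌋₊ := by exact_mod_cast hC u hu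
      _ ≤ d * (R / d) := by gcongr; exact Nat.floor_le (by positivity)
      _ = R * (d / d) := mul_div_left_comm _ _ _
      _ ≤ R := mul_le_of_le_one_right hR (div_self_le_one _)
  have hcard : (⌊R / d⌋₊ + 1 : ℝ≥0∞) ^ d = C.card := by rw [hCcard]; push_cast; rfl
  rw [hcard]
  refine card_mul_le_interaction fun u hu => ?_
  have hzu : s z = s u := by_contra fun h => ((hs u h).trans_le (hCR u hu)).false
  have hu' : u ∈ l1thickening R N := ⟨z, hz, hCR u hu⟩
  have hrow : Prod.mk u ⁻¹' (changeSet s ∩ Prod.fst ⁻¹' l1thickening R N) =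
      Prod.mk z ⁻¹' changeSet s := by
    ext w
    simp [changeSet, hzu, hu']
  rw [hrow]
  refine siteInteraction_le_of_l1dist_le hJ hα (fun h => h hzu) fun w hw => ?_
  exact_mod_cast (hCR u hu).trans (hs w hw).le

theorem siteInteraction_changeSet_le [Nonempty (Fin d)] (hJ : 0 ≤ J) (hα : 0 < α) (hR : 0 < R)
    {z : Site d} (hz : z ∈ N) (hs : ∀ w, s z ≠ s w → R < l1dist z w) :
    siteInteraction J α z (Prod.mk z ⁻¹' changeSet s) ≤ ENNReal.ofReal (2 ^ α * (d / R) ^ d) *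
      interaction J α (changeSet s ∩ Prod.fst ⁻¹' l1thickening R N) := by
  have hd : (0 : ℝ) < d := Nat.cast_pos.2 (Fin.pos_iff_nonempty.2 ‹_›)
  have hfloor : ENNReal.ofReal (R / d) ≤ (⌊R / d⌋₊ + 1 : ℝ≥0∞) := by
    rw [← Nat.cast_succ, ← ENNReal.ofReal_natCast]
    exact ENNReal.ofReal_le_ofReal (by push_cast; exact (Nat.lt_floor_add_one _).le)
  have hone : ENNReal.ofReal ((d / R) ^ d) * ENNReal.ofReal (R / d) ^ d = 1 := by
    rw [← ENNReal.ofReal_pow (by positivity), ← ENNReal.ofReal_mul (by positivity), ← mul_pow,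
      div_mul_div_cancel₀ hR.ne', div_self hd.ne', one_pow, ENNReal.ofReal_one]
  set ψ := siteInteraction J α z (Prod.mk z ⁻¹' changeSet s)
  calc ψ = ENNReal.ofReal ((d / R) ^ d) * (ENNReal.ofReal (R / d) ^ d * ψ) := by
        rw [← mul_assoc, hone, one_mul]
    _ ≤ ENNReal.ofReal ((d / R) ^ d) * ((⌊R / d⌋₊ + 1 : ℝ≥0∞) ^ d * ψ) := by gcongr
    _ ≤ ENNReal.ofReal ((d / R) ^ d) * (ENNReal.ofReal (2 ^ α) *
          interaction J α (changeSet s ∩ Prod.fst ⁻¹' l1thickening R N)) := by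
        gcongr _ * ?_
        exact pow_mul_siteInteraction_changeSet_le hJ hα hR.le hz hs
    _ = _ := by rw [← mul_assoc, ← ENNReal.ofReal_mul (by positivity), mul_comm ((d / R) ^ d)]

theorem interaction_changeSet_fst_le [Nonempty (Fin d)] (hJ : 0 ≤ J) (hα : 0 < α) (hR : 0 < R)
    (hN : N.Finite) (hs : ∀ z ∈ N, ∀ w, s z ≠ s w → R < l1dist z w) :
    interaction J α (changeSet s ∩ Prod.fst ⁻¹' N) ≤
      ENNReal.ofReal (N.ncard * (2 ^ α * (d / R) ^ d)) *
        interaction J α (changeSet s ∩ Prod.fst ⁻¹' l1thickening R N) := by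
  rw [ENNReal.ofReal_mul (Nat.cast_nonneg _), ENNReal.ofReal_natCast, mul_assoc]
  refine interaction_le_ncard_mul hN (fun p hp => hp.2) fun z hz => ?_
  exact (measure_mono fun w hw => hw.1).trans
    (siteInteraction_changeSet_le hJ hα hR hz (hs z hz))

end Average

theorem sum_mul_measure_inter_le {X ι : Type*} [MeasurableSpace X] (μ : Measure X)
    {P : Finset ι} {D : ι → ℕ} {T : ι → Set X} (f : ℕ → ℝ≥0∞) (S : Set X)
    (hT : ∀ i ∈ P, MeasurableSet (T i))
    (hdisj : ∀ i ∈ P, ∀ j ∈ P, i ≠ j → D i = D j → Disjoint (T i) (T j)) :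
    ∑ i ∈ P, f (D i) * μ (S ∩ T i) ≤ (∑' m, f m) * μ S := by
  classical
  have hfiber : ∀ m, ∑ i ∈ P with D i = m, f (D i) * μ (S ∩ T i) ≤ f m * μ S := fun m => by
    have hmem : ∀ i ∈ P.filter (D · = m), i ∈ P ∧ D i = m := fun i hi => Finset.mem_filter.1 hi
    calc ∑ i ∈ P with D i = m, f (D i) * μ (S ∩ T i)
        = f m * ∑ i ∈ P with D i = m, μ.restrict S (T i) := by
          rw [Finset.mul_sum]
          refine Finset.sum_congr rfl fun i hi => ?_
          rw [(hmem i hi).2, Measure.restrict_apply (hT i (hmem i hi).1), Set.inter_comm]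
      _ = f m * μ.restrict S (⋃ i ∈ P.filter (D · = m), T i) := by
          rw [measure_biUnion_finset (fun i hi j hj hij => ?_) fun i hi => hT i (hmem i hi).1]
          obtain ⟨hiP, hiD⟩ := hmem i hi
          obtain ⟨hjP, hjD⟩ := hmem j hj
          exact hdisj i hiP j hjP hij (hiD.trans hjD.symm)
      _ ≤ f m * μ S := by
          rw [← Measure.restrict_apply_univ S]
          exact mul_le_mul_right (measure_mono (Set.subset_univ _)) _
  calc ∑ i ∈ P, f (D i) * μ (S ∩ T i)
      = ∑ m ∈ P.image D, ∑ i ∈ P with D i = m, f (D i) * μ (S ∩ T i) :=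
        (Finset.sum_fiberwise_of_maps_to (fun _ => Finset.mem_image_of_mem D) _).symm
    _ ≤ ∑ m ∈ P.image D, f m * μ S := Finset.sum_le_sum fun m _ => hfiber m
    _ ≤ (∑' m, f m) * μ S := by
        rw [← Finset.sum_mul]
        gcongr
        exact ENNReal.sum_le_tsum _

/-- What the interaction bound uses about the spins of the contours: `D γ` is the scale of `γ`, the
region where `s γ` is negative has at most `K * D γ ^ d` points and stays close to `γ`, and the
distance of two contours is large compared with the smaller of their scales. -/
structure IsSeparatedFamily (K M a : ℝ) (P : Finset (Finset (Site d)))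
    (s : Finset (Site d) → Config d) (D : Finset (Site d) → ℕ) : Prop where
  one_le : ∀ γ ∈ P, 1 ≤ D γ
  isLocallyConstantOff : ∀ γ ∈ P, IsLocallyConstantOff (γ : Set (Site d)) (s γ)
  finite : ∀ γ ∈ P, (minusRegion (s γ)).Finite
  ncard_le : ∀ γ ∈ P, ((minusRegion (s γ)).ncard : ℝ) ≤ K * (D γ : ℝ) ^ d
  near : ∀ γ ∈ P, minusRegion (s γ) ⊆ l1thickening (M * (D γ : ℝ) ^ a / 4) γ
  separated : ∀ γ ∈ P, ∀ γ' ∈ P, γ ≠ γ' → ∀ p ∈ γ, ∀ q ∈ γ',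
    M * ((min (D γ) (D γ') : ℕ) : ℝ) ^ a < l1dist p q

namespace IsSeparatedFamily

variable {K M a J α : ℝ} {P : Finset (Finset (Site d))} {s : Finset (Site d) → Config d}
  {D : Finset (Site d) → ℕ} {γ γ' : Finset (Site d)}

theorem scale_pos (h : IsSeparatedFamily K M a P s D) (hγ : γ ∈ P) : (0 : ℝ) < D γ :=
  Nat.cast_pos.2 (h.one_le γ hγ)

theorem lt_l1dist_of_ne (h : IsSeparatedFamily K M a P s D) (hM : 0 ≤ M) (hγ : γ ∈ P)
    (hγ' : γ' ∈ P) (hne : γ ≠ γ') (hD : D γ ≤ D γ') {x y : Site d}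
    (hx : x ∈ minusRegion (s γ)) (hxy : s γ' x ≠ s γ' y) :
    M * (D γ : ℝ) ^ a / 2 < l1dist x y := by
  by_contra! hle
  obtain ⟨p, hp, hpx⟩ := h.near γ hγ hx
  refine hxy ((h.isLocallyConstantOff γ' hγ').eq_of_l1ball x y fun z hz hzγ' => ?_)
  have hsep := h.separated γ hγ γ' hγ' hne p hp z hzγ'
  rw [min_eq_left hD] at hsep
  have htri : (l1dist p z : ℝ) ≤ l1dist p x + l1dist x z := by
    exact_mod_cast l1dist_triangle p x z
  have hz' : (l1dist x z : ℝ) ≤ l1dist x y := by exact_mod_cast hz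
  have : 0 ≤ M * (D γ : ℝ) ^ a := by positivity
  linarith

theorem disjoint_l1thickening (h : IsSeparatedFamily K M a P s D) (hγ : γ ∈ P) (hγ' : γ' ∈ P)
    (hne : γ ≠ γ') (hD : D γ = D γ') :
    Disjoint (l1thickening (M * (D γ : ℝ) ^ a / 4) (minusRegion (s γ)))
      (l1thickening (M * (D γ' : ℝ) ^ a / 4) (minusRegion (s γ'))) := by
  rw [Set.disjoint_left]
  rintro u ⟨z, hz, hzu⟩ ⟨z', hz', hzu'⟩
  obtain ⟨p, hp, hpz⟩ := h.near γ hγ hz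
  obtain ⟨p', hp', hpz'⟩ := h.near γ' hγ' hz'
  have hsep := h.separated γ hγ γ' hγ' hne p hp p' hp'
  rw [← hD] at hzu' hpz' hsep
  rw [min_self] at hsep
  have htri : l1dist p p' ≤ l1dist p z + l1dist z u + l1dist z' u + l1dist p' z' := by
    have h₁ := l1dist_triangle p z p'
    have h₂ := l1dist_triangle z u p'
    have h₃ := l1dist_triangle u z' p'
    rw [l1dist_comm u z', l1dist_comm z' p'] at h₃
    omega
  have htri' : (l1dist p p' : ℝ) ≤ l1dist p z + l1dist z u + l1dist z' u + l1dist p' z' := by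
    exact_mod_cast htri
  linarith

theorem interaction_larger_le (h : IsSeparatedFamily K M a P s D) (hM : 0 < M) (ha : 0 < a)
    (hJ : 0 ≤ J) (hβ : (d : ℝ) < α - d / a) (hγ : γ ∈ P) :
    interaction J α {p | p.1 ∈ minusRegion (s γ) ∧
        ∃ γ' ∈ P, γ' ≠ γ ∧ D γ ≤ D γ' ∧ p ∈ changeSet (s γ')} ≤
      ENNReal.ofReal (K * latticeSum d (α - d / a) * (M / 2) ^ (-(d / a)) * J) := by
  have hD := h.scale_pos hγ
  have hda : 0 ≤ (d : ℝ) / a := by positivity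
  set B := latticeSum d (α - d / a)
  have hB : 0 ≤ B := latticeSum_nonneg d _
  have hrow : ∀ x ∈ minusRegion (s γ), siteInteraction J α x (Prod.mk x ⁻¹'
      {p | p.1 ∈ minusRegion (s γ) ∧ ∃ γ' ∈ P, γ' ≠ γ ∧ D γ ≤ D γ' ∧ p ∈ changeSet (s γ')}) ≤
      ENNReal.ofReal (J * (M * (D γ : ℝ) ^ a / 2) ^ (α - d / a - α) * B) := fun x hx => by
    refine siteInteraction_le_of_forall_le hβ (by linarith) hJ (by positivity) ?_
    rintro y ⟨-, γ', hγ', hne, hDD, hxy⟩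
    exact (h.lt_l1dist_of_ne hM.le hγ hγ' hne.symm hDD hx hxy).le
  refine (interaction_le_ncard_mul (h.finite γ hγ) (fun p hp => hp.1) hrow).trans ?_
  rw [← ENNReal.ofReal_natCast, ← ENNReal.ofReal_mul (Nat.cast_nonneg _)]
  refine ENNReal.ofReal_le_ofReal ?_
  have hpow : (D γ : ℝ) ^ d * ((D γ : ℝ) ^ a) ^ (-(d / a)) = 1 := by
    rw [← Real.rpow_mul hD.le, mul_neg, mul_div_cancel₀ _ ha.ne', Real.rpow_neg hD.le,
      Real.rpow_natCast, mul_inv_cancel₀ (by positivity)]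
  calc ((minusRegion (s γ)).ncard : ℝ) * (J * (M * (D γ : ℝ) ^ a / 2) ^ (α - d / a - α) * B)
      ≤ K * (D γ : ℝ) ^ d * (J * (M * (D γ : ℝ) ^ a / 2) ^ (α - d / a - α) * B) :=
        mul_le_mul_of_nonneg_right (h.ncard_le γ hγ) (by positivity)
    _ = K * B * (M / 2) ^ (-(d / a)) * J *
          ((D γ : ℝ) ^ d * ((D γ : ℝ) ^ a) ^ (-(d / a))) := by
        rw [show α - d / a - α = -(d / a) by ring, mul_div_right_comm,
          Real.mul_rpow (by positivity) (by positivity)]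
        ring
    _ = K * B * (M / 2) ^ (-(d / a)) * J := by rw [hpow, mul_one]

theorem interaction_changeSet_minusRegion_le [Nonempty (Fin d)]
    (h : IsSeparatedFamily K M a P s D) (hM : 0 < M) (hJ : 0 ≤ J) (hα : 0 < α)
    (hγ : γ ∈ P) (hγ' : γ' ∈ P) (hD : D γ' < D γ) :
    interaction J α (changeSet (s γ) ∩ Prod.fst ⁻¹' minusRegion (s γ')) ≤
      ENNReal.ofReal (2 ^ α * K * (4 * d / M) ^ d * (D γ' : ℝ) ^ ((1 - a) * d)) *
        interaction J α (changeSet (s γ) ∩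
          Prod.fst ⁻¹' l1thickening (M * (D γ' : ℝ) ^ a / 4) (minusRegion (s γ'))) := by
  have hD0 := h.scale_pos hγ'
  set R := M * (D γ' : ℝ) ^ a / 4 with hR
  have hR0 : 0 < R := by positivity
  refine (interaction_changeSet_fst_le hJ hα hR0 (h.finite γ' hγ') fun z hz w hw => ?_).trans ?_
  · have hlt := h.lt_l1dist_of_ne hM.le hγ' hγ (fun e => hD.ne (e ▸ rfl)) hD.le hz hw
    linarith
  refine mul_le_mul_left (ENNReal.ofReal_le_ofReal ?_) _
  calc ((minusRegion (s γ')).ncard : ℝ) * (2 ^ α * (d / R) ^ d)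
      ≤ K * (D γ' : ℝ) ^ d * (2 ^ α * (d / R) ^ d) := by gcongr; exact h.ncard_le γ' hγ'
    _ = 2 ^ α * K * ((4 * d / M) * ((D γ' : ℝ) / (D γ' : ℝ) ^ a)) ^ d := by
        rw [show 4 * d / M * ((D γ' : ℝ) / (D γ' : ℝ) ^ a) = D γ' * (d / R) by rw [hR]; field_simp,
          mul_pow]
        ring
    _ = 2 ^ α * K * (4 * d / M) ^ d * (D γ' : ℝ) ^ ((1 - a) * d) := by
        rw [mul_pow, Real.rpow_mul_natCast hD0.le, Real.rpow_sub hD0, Real.rpow_one,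
          ← mul_assoc]

theorem interaction_smaller_le [Nonempty (Fin d)] (h : IsSeparatedFamily K M a P s D)
    (hM : 0 < M) (hK : 0 ≤ K) (ha : (1 - a) * d < -1) (hJ : 0 ≤ J) (hα : 0 < α) (hγ : γ ∈ P) :
    interaction J α {p | p ∈ changeSet (s γ) ∧ ∃ γ' ∈ P, D γ' < D γ ∧ p.1 ∈ minusRegion (s γ')} ≤
      ENNReal.ofReal (2 ^ α * K * (4 * d / M) ^ d * ∑' m : ℕ, (m : ℝ) ^ ((1 - a) * d)) *
        interaction J α (changeSet (s γ)) := by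
  set A : ℝ := 2 ^ α * K * (4 * d / M) ^ d
  have : 0 ≤ A := by positivity
  set Q := P.filter (D · < D γ)
  have hQ : ∀ γ' ∈ Q, γ' ∈ P ∧ D γ' < D γ := fun γ' hγ' => Finset.mem_filter.1 hγ'
  calc interaction J α {p | p ∈ changeSet (s γ) ∧
          ∃ γ' ∈ P, D γ' < D γ ∧ p.1 ∈ minusRegion (s γ')}
      ≤ interaction J α (⋃ γ' ∈ Q, changeSet (s γ) ∩ Prod.fst ⁻¹' minusRegion (s γ')) := by
        refine measure_mono ?_
        rintro p ⟨hp, γ', hγ', hD, hpγ'⟩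
        exact Set.mem_biUnion (Finset.mem_filter.2 ⟨hγ', hD⟩) ⟨hp, hpγ'⟩
    _ ≤ ∑ γ' ∈ Q, interaction J α (changeSet (s γ) ∩ Prod.fst ⁻¹' minusRegion (s γ')) :=
        measure_biUnion_finset_le _ _
    _ ≤ ∑ γ' ∈ Q, ENNReal.ofReal (A * (D γ' : ℝ) ^ ((1 - a) * d)) *
          interaction J α (changeSet (s γ) ∩
            Prod.fst ⁻¹' l1thickening (M * (D γ' : ℝ) ^ a / 4) (minusRegion (s γ'))) :=
        Finset.sum_le_sum fun γ' hγ' =>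
          h.interaction_changeSet_minusRegion_le hM hJ hα hγ (hQ γ' hγ').1 (hQ γ' hγ').2
    _ ≤ (∑' m : ℕ, ENNReal.ofReal (A * (m : ℝ) ^ ((1 - a) * d))) *
          interaction J α (changeSet (s γ)) :=
        sum_mul_measure_inter_le _ (fun m : ℕ => ENNReal.ofReal (A * (m : ℝ) ^ ((1 - a) * d))) _
          (fun _ _ => .of_discrete) fun γ₁ h₁ γ₂ h₂ hne hD =>
            (h.disjoint_l1thickening (hQ γ₁ h₁).1 (hQ γ₂ h₂).1 hne hD).preimage _
    _ = ENNReal.ofReal (A * ∑' m : ℕ, (m : ℝ) ^ ((1 - a) * d)) *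
          interaction J α (changeSet (s γ)) := by
        rw [← tsum_mul_left, ENNReal.ofReal_tsum_of_nonneg (fun m => by positivity)
          ((Real.summable_nat_rpow.2 ha).mul_left A)]

end IsSeparatedFamily

/-- The part of the interaction across the boundary of the negative region of one contour spin that
goes to pairs also separated by another contour spin is at most this fraction of the whole. The
first term is due to the contours of larger scale, the second to those of smaller scale. -/
noncomputable def interactionBound (d : ℕ) (K α a M : ℝ) : ℝ :=
  K * latticeSum d (α - d / a) * (M / 2) ^ (-(d / a)) +
    4 * (2 ^ α * K * (4 * d / M) ^ d * ∑' m : ℕ, (m : ℝ) ^ ((1 - a) * d))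

theorem tendsto_interactionBound (hd : 0 < d) (K α : ℝ) {a : ℝ} (ha : 0 < a) :
    Filter.Tendsto (interactionBound d K α a) Filter.atTop (nhds 0) := by
  have hlarger : Filter.Tendsto (fun M : ℝ => (M / 2) ^ (-((d : ℝ) / a))) Filter.atTop (nhds 0) :=
    (tendsto_rpow_neg_atTop (by positivity)).comp (Filter.tendsto_id.atTop_div_const (by norm_num))
  have hsmaller : Filter.Tendsto (fun M : ℝ => (4 * d / M) ^ d) Filter.atTop (nhds 0) := by
    simpa [hd.ne'] using (Filter.tendsto_id.const_div_atTop (4 * (d : ℝ))).pow d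
  have hsum := (hlarger.const_mul (K * latticeSum d (α - d / a))).add
    (((hsmaller.const_mul (2 ^ α * K)).mul_const (∑' m : ℕ, (m : ℝ) ^ ((1 - a) * d))).const_mul 4)
  simp only [mul_zero, zero_mul, add_zero] at hsum
  exact hsum

theorem ofReal_le_interaction_cut [Nonempty (Fin d)] {J α : ℝ} {A : Set (Site d)} (hA : A.Finite)
    (hne : A.Nonempty) : ENNReal.ofReal J ≤ interaction J α (cut A) := by
  obtain ⟨x, hx, y, hy, hxy⟩ := exists_boundary_edge hne fun e => Set.infinite_univ (e ▸ hA)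
  have hcut : y ∈ Prod.mk x ⁻¹' cut A := ⟨hx, hy⟩
  exact (ofReal_le_siteInteraction hxy hcut).trans (siteInteraction_le_interaction x)

/-- The pairs of sites separated by the negative region of the spin of `γ` whose interaction is also
affected by the spin of another member of `P`. -/
def sharedCut (P : Finset (Finset (Site d))) (s : Finset (Site d) → Config d)
    (γ : Finset (Site d)) : Set (Site d × Site d) :=
  cut (minusRegion (s γ)) ∩ {p | ∃ γ' ∈ P, γ' ≠ γ ∧ p ∈ changeSet (s γ')}

theorem sharedCut_subset (D : Finset (Site d) → ℕ) (s : Finset (Site d) → Config d)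
    (P : Finset (Finset (Site d))) (γ : Finset (Site d)) :
    sharedCut P s γ ⊆
      {p | p.1 ∈ minusRegion (s γ) ∧ ∃ γ' ∈ P, γ' ≠ γ ∧ D γ ≤ D γ' ∧ p ∈ changeSet (s γ')} ∪
        ({p | p ∈ changeSet (s γ) ∧ ∃ γ' ∈ P, D γ' < D γ ∧ p.1 ∈ minusRegion (s γ')} ∪
          Prod.swap ⁻¹'
            {p | p ∈ changeSet (s γ) ∧ ∃ γ' ∈ P, D γ' < D γ ∧ p.1 ∈ minusRegion (s γ')}) := by
  rintro ⟨x, y⟩ ⟨⟨hx, hy⟩, γ', hγ', hne, hxy⟩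
  rcases le_or_gt (D γ) (D γ') with hD | hD
  · exact Or.inl ⟨hx, γ', hγ', hne, hD, hxy⟩
  have hγxy : s γ x ≠ s γ y := by rwa [notMem_minusRegion.1 hy]
  by_cases hx' : s γ' x = 1
  · exact Or.inr (Or.inr ⟨hγxy.symm, γ', hγ', hD, fun hy' => hxy (hx'.trans hy'.symm)⟩)
  · exact Or.inr (Or.inl ⟨hγxy, γ', hγ', hD, hx'⟩)

namespace IsSeparatedFamily

variable {K M a J α : ℝ} {P : Finset (Finset (Site d))} {s : Finset (Site d) → Config d}
  {D : Finset (Site d) → ℕ} {γ : Finset (Site d)}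

theorem interaction_sharedCut_le [Nonempty (Fin d)] (h : IsSeparatedFamily K M a P s D)
    (hM : 0 < M) (hK : 0 ≤ K) (ha : 0 < a) (ha' : (1 - a) * d < -1) (hJ : 0 ≤ J) (hα : 0 < α)
    (hβ : (d : ℝ) < α - d / a) (hγ : γ ∈ P) (hne : (minusRegion (s γ)).Nonempty) :
    interaction J α (sharedCut P s γ) ≤
      ENNReal.ofReal (interactionBound d K α a M) * interaction J α (cut (minusRegion (s γ))) := by
  set larger := K * latticeSum d (α - d / a) * (M / 2) ^ (-(d / a))
  set smaller := 2 ^ α * K * (4 * d / M) ^ d * ∑' m : ℕ, (m : ℝ) ^ ((1 - a) * d)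
  have hlarger0 : 0 ≤ larger := by have := latticeSum_nonneg d (α - d / a); positivity
  have : 0 ≤ smaller :=
    mul_nonneg (by positivity) (tsum_nonneg fun m => by positivity)
  have hlarger := (h.interaction_larger_le hM ha hJ hβ hγ).trans <|
    (ENNReal.ofReal_mul hlarger0).trans_le <|
      mul_le_mul_right (ofReal_le_interaction_cut (α := α) (h.finite γ hγ) hne) _
  have hsmaller := (h.interaction_smaller_le hM hK ha' hJ hα hγ).trans
    (mul_le_mul_right (interaction_changeSet_le (s γ)) _)
  refine (measure_mono (sharedCut_subset D s P γ)).trans ?_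
  refine ((measure_union_le _ _).trans (add_le_add hlarger
    ((measure_union_le _ _).trans (add_le_add hsmaller
      ((interaction_preimage_swap _).trans_le hsmaller))))).trans_eq ?_
  rw [interactionBound, ENNReal.ofReal_add hlarger0 (by positivity),
    ENNReal.ofReal_mul (by norm_num : (0 : ℝ) ≤ 4), ENNReal.ofReal_ofNat]
  ring

theorem interaction_real_sharedCut_le [Nonempty (Fin d)] {ε : ℝ}
    (h : IsSeparatedFamily K M a P s D)
    (hM : 0 < M) (hK : 0 ≤ K) (ha : 0 < a) (ha' : (1 - a) * d < -1) (hJ : 0 ≤ J)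
    (hα : (d : ℝ) < α) (hβ : (d : ℝ) < α - d / a) (hγ : γ ∈ P)
    (hne : (minusRegion (s γ)).Nonempty) (hε : 0 ≤ ε) (hbound : interactionBound d K α a M ≤ ε) :
    (interaction J α).real (sharedCut P s γ) ≤ ε * surfaceEnergy J α (minusRegion (s γ)) := by
  have hfin : interaction J α (cut (minusRegion (s γ))) ≠ ∞ :=
    interaction_ne_top hα hJ (h.finite γ hγ) fun p hp => hp.1
  have hle := (h.interaction_sharedCut_le hM hK ha ha' hJ (d.cast_nonneg.trans_lt hα) hβ hγ
    hne).trans (mul_le_mul_left (ENNReal.ofReal_le_ofReal hbound) _)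
  rw [surfaceEnergy_eq hα hJ]
  simpa [hε, Measure.real] using ENNReal.toReal_mono (by finiteness) hle

end IsSeparatedFamily

/-! ### The energy of a product of two configurations -/

section Hamiltonian

variable {J α : ℝ} {Λ : Finset (Site d)} {σ θ : Config d}

theorem siteInteraction_real (hJ : 0 ≤ J) (α : ℝ) (x : Site d) (S : Set (Site d)) :
    (siteInteraction J α x).real S = ∑' y, S.indicator (coupling J α x) y := by
  classical
  rw [Measure.real, siteInteraction_apply, ENNReal.tsum_toReal_eq fun y => ?_]
  · refine tsum_congr fun y => ?_
    rw [Set.indicator_apply, Set.indicator_apply, apply_ite ENNReal.toReal,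
      ENNReal.toReal_ofReal (coupling_nonneg hJ α x y), ENNReal.toReal_zero]
  · rw [Set.indicator_apply]
    finiteness

theorem summable_coupling (hα : (d : ℝ) < α) (hJ : 0 ≤ J) (x : Site d) :
    Summable (coupling J α x) := by
  have hfin : ∑' y, ENNReal.ofReal (coupling J α x y) ≠ ∞ := by
    have huniv := siteInteraction_univ hα hJ x
    rw [siteInteraction_apply, Set.indicator_univ] at huniv
    rw [huniv]
    finiteness
  simpa only [ENNReal.toReal_ofReal (coupling_nonneg hJ α x _)] using ENNReal.summable_toReal hfin

theorem coupling_mul_spin_mul_spin (J α : ℝ) (σ : Config d) (x y : Site d) :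
    coupling J α x y * spin σ x * spin σ y =
      coupling J α x y - 2 * (Prod.mk x ⁻¹' changeSet σ).indicator (coupling J α x) y := by
  classical
  rcases Int.units_eq_one_or (σ x) with hx | hx <;>
    rcases Int.units_eq_one_or (σ y) with hy | hy <;>
      simp [spin, changeSet, hx, hy] <;> ring

theorem hasSum_coupling_mul_spin_mul_spin (hα : (d : ℝ) < α) (hJ : 0 ≤ J) (σ : Config d)
    (x : Site d) :
    HasSum (fun y => coupling J α x y * spin σ x * spin σ y)
      ((siteInteraction J α x).real Set.univ -
        2 * (siteInteraction J α x).real (Prod.mk x ⁻¹' changeSet σ)) := by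
  have hsum := summable_coupling hα hJ x
  simp only [coupling_mul_spin_mul_spin, siteInteraction_real hJ, Set.indicator_univ]
  exact hsum.hasSum.sub ((hsum.indicator _).hasSum.mul_left 2)

theorem interaction_real_inter_fst (hα : (d : ℝ) < α) (hJ : 0 ≤ J) (Λ : Finset (Site d))
    (S : Set (Site d × Site d)) :
    (interaction J α).real (S ∩ Prod.fst ⁻¹' Λ) =
      ∑ x ∈ Λ, (siteInteraction J α x).real (Prod.mk x ⁻¹' S) := by
  have hrow : ∀ x ∈ Λ, Prod.mk x ⁻¹' (S ∩ Prod.fst ⁻¹' Λ) = Prod.mk x ⁻¹' S := fun x hx => by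
    ext y
    simp [hx]
  have hempty : ∀ x ∉ Λ, Prod.mk x ⁻¹' (S ∩ Prod.fst ⁻¹' Λ) = ∅ := fun x hx => by
    ext y
    simp [hx]
  rw [Measure.real, interaction_apply, tsum_eq_sum (s := Λ) fun x hx => by
    rw [hempty x hx, measure_empty], Finset.sum_congr rfl fun x hx => by rw [hrow x hx]]
  refine ENNReal.toReal_sum fun x _ => measure_ne_top_of_subset (Set.subset_univ _) ?_
  rw [siteInteraction_univ hα hJ]
  finiteness

theorem hamiltonian_plus_eq (hα : (d : ℝ) < α) (hJ : 0 ≤ J)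
    (hσ : σ ∈ configsWithBC Λ (plus d)) :
    hamiltonian J α Λ (plus d) σ =
      2 * (interaction J α).real (changeSet σ ∩ Prod.fst ⁻¹' Λ) -
        ∑ x ∈ Λ, (siteInteraction J α x).real Set.univ := by
  have hplus : ∀ y : {y // y ∉ Λ}, spin (plus d) y = spin σ y := fun y => by
    rw [spin, spin, hσ y y.2]
  have hrow : ∀ x, ∑ y ∈ Λ, coupling J α x y * spin σ x * spin σ y +
      ∑' y : {y // y ∉ Λ}, coupling J α x y * spin σ x * spin (plus d) y =
        (siteInteraction J α x).real Set.univ -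
          2 * (siteInteraction J α x).real (Prod.mk x ⁻¹' changeSet σ) := fun x => by
    have hsum := hasSum_coupling_mul_spin_mul_spin hα hJ σ x
    simp only [hplus, ← hsum.tsum_eq]
    exact hsum.summable.sum_add_tsum_subtype_compl Λ
  rw [hamiltonian, ← neg_add', ← Finset.sum_add_distrib, Finset.sum_congr rfl fun x _ => hrow x,
    Finset.sum_sub_distrib, ← Finset.mul_sum, ← interaction_real_inter_fst hα hJ, neg_sub]

theorem changeSet_mul (σ θ : Config d) :
    changeSet (σ * θ) = symmDiff (changeSet σ) (changeSet θ) := by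
  ext ⟨x, y⟩
  rcases Int.units_eq_one_or (σ x) with hx | hx <;>
    rcases Int.units_eq_one_or (σ y) with hy | hy <;>
    rcases Int.units_eq_one_or (θ x) with hx' | hx' <;>
    rcases Int.units_eq_one_or (θ y) with hy' | hy' <;>
    simp [changeSet, Set.mem_symmDiff, hx, hy, hx', hy']

theorem hamiltonian_mul_sub (hα : (d : ℝ) < α) (hJ : 0 ≤ J)
    (hσ : σ ∈ configsWithBC Λ (plus d)) (hθ : minusRegion θ ⊆ Λ) :
    hamiltonian J α Λ (plus d) (σ * θ) - hamiltonian J α Λ (plus d) σ =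
      4 * (interaction J α).real (changeSet θ ∩ changeSet (σ * θ) ∩ Prod.fst ⁻¹' Λ) -
        2 * (interaction J α).real (changeSet θ ∩ Prod.fst ⁻¹' Λ) := by
  have hτ : σ * θ ∈ configsWithBC Λ (plus d) := fun x hx => by
    rw [Pi.mul_apply, hσ x hx, notMem_minusRegion.1 fun h => hx (hθ h), mul_one]
  have hfin : ∀ S, interaction J α (S ∩ Prod.fst ⁻¹' (Λ : Set (Site d))) ≠ ∞ := fun S =>
    interaction_ne_top hα hJ Λ.finite_toSet fun p hp => hp.2
  have hsplit : changeSet σ = symmDiff (changeSet (σ * θ)) (changeSet θ) := by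
    rw [changeSet_mul, symmDiff_symmDiff_cancel_right]
  rw [hamiltonian_plus_eq hα hJ hτ, hamiltonian_plus_eq hα hJ hσ, hsplit,
    Set.inter_symmDiff_distrib_right, Set.inter_inter_distrib_right,
    measureReal_symmDiff_eq .of_discrete .of_discrete (hfin _) (hfin _)]
  have hθsum := measureReal_inter_add_sdiff (s := changeSet θ ∩ Prod.fst ⁻¹' Λ)
    (t := changeSet (σ * θ) ∩ Prod.fst ⁻¹' Λ) .of_discrete (hfin (changeSet θ))
  have hτsum := measureReal_inter_add_sdiff (s := changeSet (σ * θ) ∩ Prod.fst ⁻¹' Λ)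
    (t := changeSet θ ∩ Prod.fst ⁻¹' Λ) .of_discrete (hfin (changeSet (σ * θ)))
  rw [Set.inter_comm] at hτsum
  linarith

theorem hamiltonian_mul_sub_le (hα : (d : ℝ) < α) (hJ : 0 ≤ J)
    (hσ : σ ∈ configsWithBC Λ (plus d)) (hθ : minusRegion θ ⊆ Λ) :
    hamiltonian J α Λ (plus d) (σ * θ) - hamiltonian J α Λ (plus d) σ ≤
      8 * (interaction J α).real (cut (minusRegion θ) ∩ changeSet (σ * θ)) -
        2 * (interaction J α).real (cut (minusRegion θ)) := by
  set S := cut (minusRegion θ) ∩ changeSet (σ * θ)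
  have hS : interaction J α S ≠ ∞ :=
    interaction_ne_top hα hJ Λ.finite_toSet fun p hp => hθ hp.1.1
  have hswap : interaction J α (Prod.swap ⁻¹' S) = interaction J α S := interaction_preimage_swap S
  have hboth : (interaction J α).real (changeSet θ ∩ changeSet (σ * θ) ∩ Prod.fst ⁻¹' Λ) ≤
      2 * (interaction J α).real S :=
    calc (interaction J α).real (changeSet θ ∩ changeSet (σ * θ) ∩ Prod.fst ⁻¹' Λ)
        ≤ (interaction J α).real (S ∪ Prod.swap ⁻¹' S) := by
          refine measureReal_mono ?_ (measure_union_ne_top hS (hswap.trans_ne hS))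
          rintro p ⟨⟨hp, hp'⟩, -⟩
          rw [changeSet_eq_union] at hp
          exact hp.imp (fun h => ⟨h, hp'⟩) fun h => ⟨h, fun e => hp' e.symm⟩
      _ ≤ 2 * (interaction J α).real S := by
          refine (measureReal_union_le _ _).trans_eq ?_
          rw [Measure.real, Measure.real, hswap, two_mul]
  have hcut : (interaction J α).real (cut (minusRegion θ)) ≤
      (interaction J α).real (changeSet θ ∩ Prod.fst ⁻¹' Λ) := by
    refine measureReal_mono (fun p hp => ⟨?_, hθ hp.1⟩)
      (interaction_ne_top hα hJ Λ.finite_toSet fun p hp => hp.2)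
    rw [changeSet_eq_union]
    exact Or.inl hp
  rw [hamiltonian_mul_sub hα hJ hσ hθ]
  linarith

end Hamiltonian

/-! ### Energy gained by removing external contours -/

namespace IsContourPartition

variable {M a r : ℝ} {σ : Config d} {P : Finset (Finset (Site d))}
  {s : Finset (Site d) → Config d}

theorem exists_isSeparatedFamily [Nontrivial (Fin d)] {n : ℕ} (hP : IsContourPartition M a r σ P)
    (hs : ∀ γ ∈ P, IsContourSpin σ γ (s γ)) (hn : (2 : ℝ) ^ r - 1 ≤ n) (hM : 8 * n ≤ M)
    (ha : 1 ≤ a) : ∃ D, IsSeparatedFamily (n * (4 * n + 3) ^ d) M a P s D := by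
  obtain ⟨pieces, hpieces, hsep⟩ := hP.separated
  have hcard : ∀ γ ∈ P, (pieces γ).card ≤ n := fun γ hγ => by
    exact_mod_cast (hpieces γ hγ).2.1.trans hn
  set D : Finset (Site d) → ℕ := fun γ => max 1 (maxDiam (pieces γ))
  have hD : ∀ γ, 1 ≤ D γ := fun γ => le_max_left _ _
  have hdiam : ∀ γ, maxDiam (pieces γ) ≤ D γ := fun γ => le_max_right _ _
  have hreach : ∀ γ ∈ P, (pieces γ).card * (maxDiam (pieces γ) + 1) ≤ n * (2 * D γ) :=
    fun γ hγ => Nat.mul_le_mul (hcard γ hγ) (by linarith [hD γ, hdiam γ])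
  refine ⟨D, fun γ _ => hD γ, fun γ hγ => (hs γ hγ).isLocallyConstantOff,
    fun γ hγ => (hs γ hγ).finite, fun γ hγ => ?_, fun γ hγ x hx => ?_,
    fun γ hγ γ' hγ' hne p hp q hq => ?_⟩
  · have hside : 2 * (maxDiam (pieces γ) + (pieces γ).card * (maxDiam (pieces γ) + 1)) + 1 ≤
        (4 * n + 3) * D γ := by
      have := hreach γ hγ
      linarith [hD γ, hdiam γ]
    rw [mul_assoc, ← mul_pow]
    exact_mod_cast ((hs γ hγ).ncard_minusRegion_le (hpieces γ hγ).2.2).trans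
      (Nat.mul_le_mul (hcard γ hγ) (Nat.pow_le_pow_left hside d))
  · obtain ⟨p, hp, hxp⟩ := (hs γ hγ).exists_l1dist_le (hpieces γ hγ).2.2 hx
    refine ⟨p, hp, ?_⟩
    calc (l1dist p x : ℝ) ≤ n * (2 * D γ) := by
          rw [l1dist_comm]
          exact_mod_cast hxp.trans (hreach γ hγ)
      _ = 8 * n * D γ / 4 := by ring
      _ ≤ M * (D γ : ℝ) ^ a / 4 := by
          gcongr
          · exact (by positivity : (0 : ℝ) ≤ 8 * n).trans hM
          · exact Real.self_le_rpow_of_one_le (Nat.one_le_cast.2 (hD γ)) ha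
  · rw [← max_min_distrib_left]
    exact hsep γ hγ γ' hγ' hne p hp q hq

end IsContourPartition

section SurfaceEnergy

variable {J α : ℝ}

theorem card_mul_le_surfaceEnergy (hα : (d : ℝ) < α) (hJ : 0 ≤ J) {s : Config d}
    (hs : (minusRegion s).Finite) {A : Finset (Site d)}
    (hA : ∀ x ∈ A, ∃ y, (lattice d).Adj x y ∧ s x ≠ s y) :
    A.card * J ≤ 2 * surfaceEnergy J α (minusRegion s) := by
  have hle : A.card * ENNReal.ofReal J ≤ 2 * interaction J α (cut (minusRegion s)) := by
    refine le_trans ?_ ((one_mul _).trans_le (interaction_changeSet_le s))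
    refine card_mul_le_interaction fun x hx => ?_
    obtain ⟨y, hxy, hne⟩ := hA x hx
    have hy : y ∈ Prod.mk x ⁻¹' changeSet s := hne
    exact (ofReal_le_siteInteraction hxy hy).trans_eq (one_mul _).symm
  have hfin : interaction J α (cut (minusRegion s)) ≠ ∞ :=
    interaction_ne_top hα hJ hs fun p hp => hp.1
  rw [surfaceEnergy_eq hα hJ]
  simpa [hJ, Measure.real] using ENNReal.toReal_mono (by finiteness) hle

theorem interaction_real_le_card (hα : (d : ℝ) < α) (hJ : 0 ≤ J) (A : Finset (Site d))
    {S : Set (Site d × Site d)} (hS : ∀ p ∈ S, p.1 ∈ A) :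
    (interaction J α).real S ≤ A.card * (J * latticeSum d α) := by
  have hle := interaction_le_ncard hα hJ A.finite_toSet hS
  have := ENNReal.toReal_mono (by finiteness) hle
  rwa [ENNReal.toReal_mul, ENNReal.toReal_natCast, Set.ncard_coe_finset,
    ENNReal.toReal_ofReal (mul_nonneg hJ (latticeSum_nonneg d α))] at this

theorem surfaceEnergy_le_card (hα : (d : ℝ) < α) (hJ : 0 ≤ J) (A : Finset (Site d)) :
    surfaceEnergy J α (A : Set (Site d)) ≤ A.card * (J * latticeSum d α) := by
  rw [surfaceEnergy_eq hα hJ]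
  exact interaction_real_le_card hα hJ A fun p hp => hp.1

theorem surfaceEnergy_sdiff_le (hα : (d : ℝ) < α) (hJ : 0 ≤ J) {N : Set (Site d)} (hN : N.Finite)
    (A : Finset (Site d)) :
    surfaceEnergy J α (N \ A) ≤ surfaceEnergy J α N + A.card * (J * latticeSum d α) := by
  rw [surfaceEnergy_eq hα hJ, surfaceEnergy_eq hα hJ]
  have hT : interaction J α (Prod.swap ⁻¹' ((A : Set (Site d)) ×ˢ N)) ≠ ∞ := by
    rw [interaction_preimage_swap]
    exact interaction_ne_top hα hJ A.finite_toSet fun p hp => hp.1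
  calc (interaction J α).real (cut (N \ A))
      ≤ (interaction J α).real (cut N ∪ Prod.swap ⁻¹' ((A : Set (Site d)) ×ˢ N)) := by
        refine measureReal_mono ?_ (measure_union_ne_top
          (interaction_ne_top hα hJ hN fun p hp => hp.1) hT)
        rintro p ⟨hp, hp'⟩
        by_cases hpN : p.2 ∈ N
        · exact Or.inr ⟨by_contra fun h => hp' ⟨hpN, h⟩, hp.1⟩
        · exact Or.inl ⟨hp.1, hpN⟩
    _ ≤ (interaction J α).real (cut N) + (interaction J α).real ((A : Set (Site d)) ×ˢ N) := by
        refine (measureReal_union_le _ _).trans_eq ?_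
        rw [Measure.real, Measure.real, Measure.real, interaction_preimage_swap]
    _ ≤ _ := by
        gcongr
        exact interaction_real_le_card hα hJ A fun p hp => hp.1

/-- The constant `c` in the bound by `-c (|γ| + F_{I_-(γ)} + F_{sp(γ)})` of the energy gained by
removing a contour. -/
noncomputable def flipConstant (d : ℕ) (J α : ℝ) : ℝ := J / (J + 4 * (J * latticeSum d α) + 2)

theorem flipConstant_pos (d : ℕ) (hJ : 0 < J) (α : ℝ) : 0 < flipConstant d J α := by
  have := latticeSum_nonneg d α
  rw [flipConstant]
  positivity

theorem flipConstant_mul_le_surfaceEnergy (hα : (d : ℝ) < α) (hJ : 0 < J) {s : Config d}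
    (hs : (minusRegion s).Finite) {A : Finset (Site d)}
    (hA : ∀ x ∈ A, ∃ y, (lattice d).Adj x y ∧ s x ≠ s y) :
    flipConstant d J α * (A.card + surfaceEnergy J α (minusRegion s \ A) +
      surfaceEnergy J α (A : Set (Site d))) ≤ surfaceEnergy J α (minusRegion s) := by
  have hcard := card_mul_le_surfaceEnergy hα hJ.le hs hA
  have hsdiff := surfaceEnergy_sdiff_le hα hJ.le hs A
  have hsupport := surfaceEnergy_le_card hα hJ.le A
  set W := J * latticeSum d α
  have hW : 0 ≤ W := mul_nonneg hJ.le (latticeSum_nonneg d α)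
  set F := surfaceEnergy J α (minusRegion s)
  rw [flipConstant, div_mul_eq_mul_div, div_le_iff₀ (by positivity)]
  calc J * (A.card + surfaceEnergy J α (minusRegion s \ A) + surfaceEnergy J α (A : Set (Site d)))
      ≤ J * (A.card + (F + A.card * W) + A.card * W) := by gcongr
    _ = (1 + 2 * W) * (A.card * J) + J * F := by ring
    _ ≤ (1 + 2 * W) * (2 * F) + J * F := by gcongr
    _ = F * (J + 4 * W + 2) := by ring

end SurfaceEnergy

theorem finite_minusRegion_of_mem_configsWithBC {Λ : Finset (Site d)} {σ : Config d}
    (hσ : σ ∈ configsWithBC Λ (plus d)) : (minusRegion σ).Finite :=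
  Λ.finite_toSet.subset fun x hx => by_contra fun hxΛ => hx (hσ x hxΛ)

namespace IsExternalFamily

variable {J α M a r : ℝ} {σ : Config d} {Λ : Finset (Site d)} {P Γ : Finset (Finset (Site d))}
  {s : Finset (Site d) → Config d} {γ : Finset (Site d)}

theorem minusRegion_subset {c : ℤˣ} (hΓ : IsExternalFamily Λ σ P Γ c)
    (hs : ∀ γ ∈ P, IsContourSpin σ γ (s γ)) (hγ : γ ∈ Γ) : minusRegion (s γ) ⊆ Λ :=
  (hs γ (hΓ.subset hγ)).minusRegion_subset_volume.trans (hΓ.volume_subset γ hγ)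

variable [Nonempty (Fin d)]

theorem minusRegion_prod_subset {c : ℤˣ} (hΓ : IsExternalFamily Λ σ P Γ c)
    (hP : IsContourPartition M a r σ P) (hs : ∀ γ ∈ P, IsContourSpin σ γ (s γ)) :
    minusRegion (∏ γ ∈ Γ, s γ) ⊆ Λ := by
  rw [hΓ.minusRegion_prod hP hs]
  exact Set.iUnion₂_subset fun γ hγ => hΓ.minusRegion_subset hs hγ

theorem cut_minusRegion_subset {c : ℤˣ} (hΓ : IsExternalFamily Λ σ P Γ c)
    (hP : IsContourPartition M a r σ P) (hs : ∀ γ ∈ P, IsContourSpin σ γ (s γ)) (hγ : γ ∈ Γ) :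
    cut (minusRegion (s γ)) ⊆
      (cut (minusRegion (∏ γ ∈ Γ, s γ)) ∩ Prod.fst ⁻¹' minusRegion (s γ)) ∪ sharedCut P s γ := by
  rintro ⟨x, y⟩ ⟨hx, hy⟩
  rw [hΓ.minusRegion_prod hP hs]
  by_cases hyN : y ∈ ⋃ γ ∈ Γ, minusRegion (s γ)
  · obtain ⟨γ', hγ', hyγ'⟩ := Set.mem_iUnion₂.1 hyN
    have hne : γ' ≠ γ := fun e => hy (e ▸ hyγ')
    have hxγ' := Set.disjoint_left.1 (hΓ.disjoint_minusRegion hP hs hγ hγ' hne) hx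
    exact Or.inr ⟨⟨hx, hy⟩, γ', hΓ.subset hγ', hne, fun e =>
      hxγ' (show s γ' x ≠ 1 from e ▸ hyγ')⟩
  · exact Or.inl ⟨⟨Set.mem_biUnion hγ hx, hyN⟩, hx⟩

theorem sum_surfaceEnergy_le {c : ℤˣ} (hΓ : IsExternalFamily Λ σ P Γ c)
    (hP : IsContourPartition M a r σ P) (hs : ∀ γ ∈ P, IsContourSpin σ γ (s γ))
    (hα : (d : ℝ) < α) (hJ : 0 ≤ J) :
    ∑ γ ∈ Γ, surfaceEnergy J α (minusRegion (s γ)) ≤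
      (interaction J α).real (cut (minusRegion (∏ γ ∈ Γ, s γ))) +
        ∑ γ ∈ Γ, (interaction J α).real (sharedCut P s γ) := by
  have hNΛ := hΓ.minusRegion_prod_subset hP hs
  set N := minusRegion (∏ γ ∈ Γ, s γ)
  have hfin : ∀ {S : Set (Site d × Site d)}, (∀ p ∈ S, p.1 ∈ Λ) → interaction J α S ≠ ∞ :=
    interaction_ne_top hα hJ Λ.finite_toSet
  have hγ_le : ∀ γ ∈ Γ, surfaceEnergy J α (minusRegion (s γ)) ≤
      (interaction J α).real (cut N ∩ Prod.fst ⁻¹' minusRegion (s γ)) +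
        (interaction J α).real (sharedCut P s γ) := fun γ hγ => by
    rw [surfaceEnergy_eq hα hJ]
    refine (measureReal_mono (hΓ.cut_minusRegion_subset hP hs hγ) (hfin ?_)).trans
      (measureReal_union_le _ _)
    rintro p (hp | hp)
    exacts [hNΛ hp.1.1, hΓ.minusRegion_subset hs hγ hp.1.1]
  have hdisj : (Γ : Set (Finset (Site d))).PairwiseDisjoint fun γ =>
      cut N ∩ Prod.fst ⁻¹' minusRegion (s γ) := fun γ hγ γ' hγ' hne =>
    ((hΓ.disjoint_minusRegion hP hs hγ hγ' hne.symm).preimage _).mono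
      Set.inter_subset_right Set.inter_subset_right
  refine (Finset.sum_le_sum hγ_le).trans ?_
  rw [Finset.sum_add_distrib, ← measureReal_biUnion_finset hdisj (fun _ _ => .of_discrete)
    fun γ _ => hfin fun p hp => hNΛ hp.1.1]
  gcongr
  exacts [hfin fun p hp => hNΛ hp.1, Set.iUnion₂_subset fun _ _ => Set.inter_subset_left]

theorem interaction_cut_inter_changeSet_le (hΓ : IsExternalFamily Λ σ P Γ 1)
    (hP : IsContourPartition M a r σ P) (hs : ∀ γ ∈ P, IsContourSpin σ γ (s γ))
    (hσ : (minusRegion σ).Finite) (hα : (d : ℝ) < α) (hJ : 0 ≤ J) :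
    (interaction J α).real
        (cut (minusRegion (∏ γ ∈ Γ, s γ)) ∩ changeSet (σ * ∏ γ ∈ Γ, s γ)) ≤
      ∑ γ ∈ Γ, (interaction J α).real (sharedCut P s γ) := by
  classical
  have hrest : σ * ∏ γ ∈ Γ, s γ = ∏ γ ∈ P \ Γ, s γ := by
    rw [hP.eq_prod_contourSpin hs hσ, ← Finset.prod_sdiff hΓ.subset, mul_assoc]
    ext1 x
    simp only [Pi.mul_apply, Int.units_mul_self, mul_one]
  refine (measureReal_mono ?_ ?_).trans (measureReal_biUnion_finset_le Γ _)
  · rintro ⟨x, y⟩ ⟨⟨hx, hy⟩, hxy⟩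
    rw [hrest] at hxy
    rw [hΓ.minusRegion_prod hP hs] at hx hy
    obtain ⟨γ, hγ, hxγ⟩ := Set.mem_iUnion₂.1 hx
    obtain ⟨γ', hγ', hγ'xy⟩ : ∃ γ' ∈ P \ Γ, s γ' x ≠ s γ' y := by
      by_contra! hall
      refine hxy ?_
      simp only [Finset.prod_apply]
      exact Finset.prod_congr rfl hall
    rw [Finset.mem_sdiff] at hγ'
    exact Set.mem_biUnion hγ ⟨⟨hxγ, fun h => hy (Set.mem_biUnion hγ h)⟩, γ', hγ'.1,
      fun e => hγ'.2 (e ▸ hγ), hγ'xy⟩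
  · refine interaction_ne_top hα hJ Λ.finite_toSet fun p hp => ?_
    obtain ⟨γ, hγ, hpγ⟩ := Set.mem_iUnion₂.1 hp
    exact hΓ.minusRegion_subset hs hγ hpγ.1.1

theorem hamiltonian_contourFlip_sub_le (hΓ : IsExternalFamily Λ σ P Γ 1)
    (hP : IsContourPartition M a r σ P) (hs : ∀ γ ∈ P, IsContourSpin σ γ (s γ))
    (hσ : σ ∈ configsWithBC Λ (plus d)) (hα : (d : ℝ) < α) (hJ : 0 ≤ J)
    (hshared : ∀ γ ∈ P, (interaction J α).real (sharedCut P s γ) ≤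
      1 / 10 * surfaceEnergy J α (minusRegion (s γ))) :
    hamiltonian J α Λ (plus d) (contourFlip Γ σ) - hamiltonian J α Λ (plus d) σ ≤
      -∑ γ ∈ Γ, surfaceEnergy J α (minusRegion (s γ)) := by
  have hσfin := finite_minusRegion_of_mem_configsWithBC hσ
  have henergy := hamiltonian_mul_sub_le hα hJ hσ (hΓ.minusRegion_prod_subset hP hs)
  have hcut := hΓ.sum_surfaceEnergy_le hP hs hα hJ
  have hchange := hΓ.interaction_cut_inter_changeSet_le hP hs hσfin hα hJ
  have hsum : ∑ γ ∈ Γ, (interaction J α).real (sharedCut P s γ) ≤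
      1 / 10 * ∑ γ ∈ Γ, surfaceEnergy J α (minusRegion (s γ)) := by
    rw [Finset.mul_sum]
    exact Finset.sum_le_sum fun γ hγ => hshared γ (hΓ.subset hγ)
  rw [hΓ.contourFlip_eq_mul hP hs hσfin]
  linarith

end IsExternalFamily

theorem exponents_lt (hd : 0 < d) {α a : ℝ} (hα : (d : ℝ) < α) (ha : 1 + 1 / (d : ℝ) < a)
    (ha' : (d : ℝ) / (α - d) < a) : (1 - a) * d < -1 ∧ (d : ℝ) < α - d / a := by
  have hd' : (0 : ℝ) < d := Nat.cast_pos.2 hd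
  have ha0 : 0 < a := (by positivity : (0 : ℝ) < 1 + 1 / d).trans ha
  constructor
  · have := (div_lt_iff₀ hd').1 (lt_sub_iff_add_lt'.2 ha)
    linarith
  · rw [lt_sub_comm, div_lt_iff₀ ha0, mul_comm]
    exact (div_lt_iff₀ (sub_pos.2 hα)).1 ha'

theorem exists_forall_interaction_real_sharedCut_le (hd : 2 ≤ d) {α a ε : ℝ} (hα : (d : ℝ) < α)
    (ha : 1 + 1 / (d : ℝ) < a) (ha' : (d : ℝ) / (α - d) < a) (r : ℝ) (hε : 0 < ε) :
    ∃ M₀ : ℝ, 2 ≤ M₀ ∧ ∀ {J M : ℝ} {σ : Config d} {P : Finset (Finset (Site d))}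
      {s : Finset (Site d) → Config d}, 0 ≤ J → M₀ ≤ M → IsContourPartition M a r σ P →
      (∀ γ ∈ P, IsContourSpin σ γ (s γ)) → ∀ γ ∈ P,
        (interaction J α).real (sharedCut P s γ) ≤ ε * surfaceEnergy J α (minusRegion (s γ)) := by
  have : Nontrivial (Fin d) := Fin.nontrivial_iff_two_le.2 hd
  have hd0 : 0 < d := two_pos.trans_le hd
  have ha1 : 1 ≤ a := (le_add_of_nonneg_right (by positivity)).trans ha.le
  obtain ⟨hscale, hdecay⟩ := exponents_lt hd0 hα ha ha'
  set n := ⌈(2 : ℝ) ^ r⌉₊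
  have hn : (2 : ℝ) ^ r - 1 ≤ n := (sub_le_self _ zero_le_one).trans (Nat.le_ceil _)
  obtain ⟨M₁, hM₁⟩ := Filter.eventually_atTop.1 ((tendsto_interactionBound hd0
    (n * (4 * n + 3) ^ d) α (one_pos.trans_le ha1)).eventually_le_const hε)
  refine ⟨max M₁ (max 2 (8 * n)), le_max_of_le_right (le_max_left _ _), ?_⟩
  intro J M σ P s hJ hM hP hs γ hγ
  obtain ⟨hM₁', hM2, hMn⟩ : M₁ ≤ M ∧ 2 ≤ M ∧ 8 * (n : ℝ) ≤ M := by simpa using hM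
  obtain ⟨D, hD⟩ := hP.exists_isSeparatedFamily hs hn hMn ha1
  exact hD.interaction_real_sharedCut_le (two_pos.trans_le hM2) (by positivity)
    (one_pos.trans_le ha1) hscale hJ hα hdecay hγ (hP.minusRegion_nonempty hs hγ) hε.le (hM₁ M hM₁')

namespace IsContourPartition

variable {J α M a r : ℝ} {σ : Config d} {P : Finset (Finset (Site d))}
  {s : Finset (Site d) → Config d} {γ : Finset (Site d)} [Nonempty (Fin d)]

theorem flipConstant_mul_le (hP : IsContourPartition M a r σ P)
    (hs : ∀ γ ∈ P, IsContourSpin σ γ (s γ)) (hσ : (minusRegion σ).Finite) (hγ : γ ∈ P)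
    (hlabel : HasLabel σ γ 1) (hα : (d : ℝ) < α) (hJ : 0 < J) :
    flipConstant d J α * (γ.card + surfaceEnergy J α (labelledInside σ γ (-1)) +
      surfaceEnergy J α (γ : Set (Site d))) ≤ surfaceEnergy J α (minusRegion (s γ)) := by
  rw [hP.labelledInside_neg_one_eq hs hσ hγ hlabel]
  exact flipConstant_mul_le_surfaceEnergy hα hJ (hs γ hγ).finite fun x hx =>
    hP.exists_adj_contourSpin_ne hs hγ hx

end IsContourPartition

theorem exponents_of_add_one_div_min_lt (hd : 0 < d) {α a : ℝ} (hα : (d : ℝ) < α)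
    (ha : ((d : ℝ) + 1) / min (α - d) 1 < a) : 1 + 1 / (d : ℝ) < a ∧ (d : ℝ) / (α - d) < a := by
  have hα' : 0 < α - d := sub_pos.2 hα
  have hmin : 0 < min (α - d) 1 := lt_min hα' one_pos
  refine ⟨lt_of_le_of_lt ?_ ha, lt_of_le_of_lt ?_ ha⟩
  · have hd1 : (1 : ℝ) ≤ d := Nat.one_le_cast.2 hd
    calc 1 + 1 / (d : ℝ) ≤ d + 1 := by
          rw [add_comm]
          gcongr
          exact (div_le_one₀ (by positivity)).2 hd1 |>.trans hd1
      _ ≤ (d + 1) / min (α - d) 1 := le_div_self (by positivity) hmin (min_le_right _ _)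
  · gcongr
    exacts [le_add_of_nonneg_right zero_le_one, min_le_left _ _]

end LongRangeIsing

open LongRangeIsing in
theorem proposition1_general (d : ℕ) (hd : 2 ≤ d) (α J : ℝ) (hα : (d : ℝ) < α) (hJ : 0 < J)
    (a r : ℝ) (ha : 1 + 1 / (d : ℝ) < a) (ha' : (d : ℝ) / (α - d) < a) :
    ∃ M₀ c₁ c₂ c₃ : ℝ, 0 < M₀ ∧ 0 < c₁ ∧ 0 < c₂ ∧ 0 < c₃ ∧
      ∀ M : ℝ, M₀ ≤ M →
      ∀ (Λ : Finset (Site d)) (σ : Config d), σ ∈ configsWithBC Λ (plus d) →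
      ∀ P : Finset (Finset (Site d)), IsContourPartition M a r σ P →
      ∀ Γ : Finset (Finset (Site d)), IsExternalFamily Λ σ P Γ 1 →
        hamiltonian J α Λ (plus d) (contourFlip Γ σ) - hamiltonian J α Λ (plus d) σ
          ≤ ∑ γ ∈ Γ, (- c₁ * (γ.card : ℝ)
              - c₂ * surfaceEnergy J α (labelledInside σ γ (-1))
              - c₃ * surfaceEnergy J α (γ : Set (Site d))) := by
  have : Nontrivial (Fin d) := Fin.nontrivial_iff_two_le.2 hd
  have ha0 : 0 ≤ a := (by positivity : (0 : ℝ) ≤ 1 + 1 / d).trans ha.le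
  have hc := flipConstant_pos d hJ α
  obtain ⟨M₀, hM₀, hshared⟩ := exists_forall_interaction_real_sharedCut_le hd hα ha ha' r
    (by norm_num : (0 : ℝ) < 1 / 10)
  refine ⟨M₀, _, _, _, two_pos.trans_le hM₀, hc, hc, hc, fun M hM Λ σ hσ P hP Γ hΓ => ?_⟩
  obtain ⟨s, hs⟩ := hP.exists_contourSpins (hM₀.trans hM) ha0
  have hflip := hΓ.hamiltonian_contourFlip_sub_le hP hs hσ hα hJ.le (hshared hJ.le hM hP hs)
  refine hflip.trans ?_
  rw [← Finset.sum_neg_distrib]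
  refine Finset.sum_le_sum fun γ hγ => ?_
  linarith [hP.flipConstant_mul_le hs (finite_minusRegion_of_mem_configsWithBC hσ)
    (hΓ.subset hγ) (hΓ.label γ hγ) hα hJ]

theorem proposition1 (d : ℕ) (hd : 2 ≤ d) (α J : ℝ) (hα : (d : ℝ) < α) (hJ : 0 < J)
    (a r : ℝ) (ha : ((d : ℝ) + 1) / min (α - d) 1 < a) (hr : 0 < r) :
    ∃ M₀ c₁ c₂ c₃ : ℝ, 0 < M₀ ∧ 0 < c₁ ∧ 0 < c₂ ∧ 0 < c₃ ∧
      ∀ M : ℝ, M₀ ≤ M →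
      ∀ (Λ : Finset (LongRangeIsing.Site d)) (σ : LongRangeIsing.Config d),
      σ ∈ LongRangeIsing.configsWithBC Λ (LongRangeIsing.plus d) →
      ∀ P : Finset (Finset (LongRangeIsing.Site d)),
      LongRangeIsing.IsContourPartition M a r σ P →
      ∀ Γ : Finset (Finset (LongRangeIsing.Site d)),
      LongRangeIsing.IsExternalFamily Λ σ P Γ 1 →
        LongRangeIsing.hamiltonian J α Λ (LongRangeIsing.plus d) (LongRangeIsing.contourFlip Γ σ)
            - LongRangeIsing.hamiltonian J α Λ (LongRangeIsing.plus d) σ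
          ≤ ∑ γ ∈ Γ, (- c₁ * (γ.card : ℝ)
              - c₂ * LongRangeIsing.surfaceEnergy J α (LongRangeIsing.labelledInside σ γ (-1))
              - c₃ * LongRangeIsing.surfaceEnergy J α (γ : Set (LongRangeIsing.Site d))) := by
  have hexp := LongRangeIsing.exponents_of_add_one_div_min_lt (two_pos.trans_le hd) hα ha
  exact proposition1_general d hd α J hα hJ a r hexp.1 hexp.2
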